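/- Lemma 3.1. For a positive integer $n$ and $p\in[0,1]$, let $B_{n,p}$ be the random bipartite graph whose parts are two disjoint copies of $\{1,\dots,n\}$ and in which each of the $n^2$ pairs with one vertex in each part is an edge with probability $p$, independently. For a finite graph $G$ let $\Delta(G)$ be its maximum degree, and let $\Delta_2(G)$ be its second largest vertex degree (the second entry of the degree sequence in decreasing order, counted with multiplicity). Let $p=p(n)\in[0,1]$ satisfy $\frac{\log^{10}n}{n}\le p(n)\le\frac12$ for all sufficiently large $n$, where $\log$ is the natural logarithm and $\log^{10} n=(\log n)^{10}$. Then, with probability tending to $1$ as $n\to\infty$, the graph $B=B_{n,p}$ has the following property. For every graph $B'$ obtained from $B$ by deleting exactly $\Delta(B)-\Delta_2(B)$ edges, all incident to one vertex of degree $\Delta(B)$, there exist two families $\mathcal M_1,\mathcal M_2$ of perfect matchings of $B'$ (each viewed as a set of edges) such that 1. for each $i\in\{1,2\}$ and all $M\ne M'$ in $\mathcal M_i$, $M\cap M'=\emptyset$; 2. $\bigcup_{M\in\mathcal M_1\cup\mathcal M_2}M=E(B')$; 3. $|\mathcal M_1|+|\mathcal M_2|=\Delta(B')$. -/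

import Mathlib

open MeasureTheory ProbabilityTheory Filter Topology unitInterval

/-- The balanced bipartite graph whose parts are two disjoint copies of `{0, …, n - 1}` (the left and
the right summand) and whose edges join the left `x` to the right `y` for `(x, y) ∈ E`. -/
def bipartiteGraph (n : ℕ) (E : Set (Fin n × Fin n)) : SimpleGraph (Fin n ⊕ Fin n) where
  Adj u v := (∃ x y, (x, y) ∈ E ∧ u = Sum.inl x ∧ v = Sum.inr y) ∨
    ∃ x y, (x, y) ∈ E ∧ u = Sum.inr y ∧ v = Sum.inl x
  symm := ⟨by
    rintro u v (⟨x, y, h, hu, hv⟩ | ⟨x, y, h, hu, hv⟩)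
    · exact Or.inr ⟨x, y, h, hv, hu⟩
    · exact Or.inl ⟨x, y, h, hv, hu⟩⟩
  loopless := ⟨by
    rintro u (⟨x, y, -, hu, hv⟩ | ⟨x, y, -, hu, hv⟩) <;> simp [hu] at hv⟩

/-- The law of the binomial random bipartite graph `B_{n,p}`: each of the `n ^ 2` pairs is an edge
with probability `p`, independently of the others. -/
noncomputable def binomialRandomBipartite (n : ℕ) (p : I) :
    Measure (SimpleGraph (Fin n ⊕ Fin n)) :=
  (setBernoulli (Set.univ : Set (Fin n × Fin n)) p).map (bipartiteGraph n)

instance (n : ℕ) (p : I) : IsProbabilityMeasure (binomialRandomBipartite n p) :=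
  Measure.isProbabilityMeasure_map (measurable_of_countable _).aemeasurable

open scoped Classical in
/-- The second largest degree `Δ₂(G)`, that is, the second entry of the degree sequence in
decreasing order, counted with multiplicity: the maximum over pairs of distinct vertices of the
smaller of their two degrees. -/
noncomputable def secondMaxDegree {V : Type*} [Fintype V] (G : SimpleGraph V) : ℕ :=
  (Finset.univ : Finset V).offDiag.sup fun e => min (G.degree e.1) (G.degree e.2)

open scoped Classical in
/-- `G'` arises from `G` by deleting exactly `Δ(G) - Δ₂(G)` edges, all of them incident to one vertex
of largest degree. -/
def IsMaxDegreeDeletion {V : Type*} [Fintype V] (G G' : SimpleGraph V) : Prop :=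
  ∃ v : V, G.degree v = G.maxDegree ∧
    ∃ F : Finset (Sym2 V), F ⊆ G.incidenceFinset v ∧
      F.card = G.maxDegree - secondMaxDegree G ∧
      G' = G.deleteEdges (F : Set (Sym2 V))

open scoped Classical in
/-- There are two families of perfect matchings of `G`, each consisting of pairwise edge-disjoint
matchings, which together cover all edges of `G` and have `Δ(G)` members in total. -/
def HasOptimalMatchingCover {V : Type*} [Fintype V] (G : SimpleGraph V) : Prop :=
  ∃ M₁ M₂ : Finset G.Subgraph,
    (∀ M ∈ M₁, M.IsPerfectMatching) ∧ (∀ M ∈ M₂, M.IsPerfectMatching) ∧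
    (∀ M ∈ M₁, ∀ M' ∈ M₁, M ≠ M' → Disjoint M.edgeSet M'.edgeSet) ∧
    (∀ M ∈ M₂, ∀ M' ∈ M₂, M ≠ M' → Disjoint M.edgeSet M'.edgeSet) ∧
    (⋃ M ∈ M₁, M.edgeSet) ∪ (⋃ M ∈ M₂, M.edgeSet) = G.edgeSet ∧
    M₁.card + M₂.card = G.maxDegree

/-! Let Δ be the second largest degree of B, which is the largest degree of B'. Suppose F is a set
of edges of B' with degree Δ - deg(x) at every vertex x. Doubling F turns B' into a Δ-regular
bipartite multigraph. This splits into two simple regular graphs: each receives F, and the remaining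
edges, whose degrees Δ - 2 deg_F all have the parity of Δ, are shared out evenly. If Δ is odd, a
perfect matching M avoiding F is set aside first and given to one of the two. König's theorem
decomposes both graphs into perfect matchings, Δ in all, and only the edges of F are covered twice
(`exists_cover_of_doubling`).

The graph F is found inside B' minus M by a max-flow min-cut criterion deduced from Hall's theorem
(`exists_subset_degrees_eq`). Call Δ - deg(x) the demand of x. The cut condition says that the
demand of S on the left is at most the demand outside T on the right plus the number of edges
between S and T. Put r = √(np) and L = log n. Demands are O(rL), because degrees deviate from r² by
at most rL. Their average has order at least r, because each side has a vertex of degree at least r²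
+ r/8, so that Δ is at least that, while the average degree is at most r² + r/16.

If S is small, each of its vertices has about r²/L neighbours of positive demand, since the
neighbours of a vertex have average degree close to r². By the upper bound on edge counts, these
neighbourhoods cannot overlap much, so their union outnumbers the demand of S; each member of the
union pays for one unit, through its own demand or through an edge. If T is small, the two sides are
exchanged. If both are large, either the edges between S and T outnumber the demand of one of them,
or S and T together carry less than the total demand. The vertex v at which edges are deleted has
demand zero and is left out of the cuts, so any other vertex loses at most one deleted edge and one
edge of M.

The random graph has these properties by Chernoff bounds and union bounds, with two exceptions.
Degrees along a neighbourhood are treated by conditioning on that neighbourhood. The existence of a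
vertex of large degree follows from Chebyshev's inequality for the sum of exp(c deg(x)) over one
side, whose terms are independent (`bernoulliProb_sum_exp_le`). -/

set_option linter.unusedSectionVars false

/-! ### Degree-constrained subgraphs, König's theorem and the doubling construction. -/

section BipartiteEdgeSets

variable {X Y : Type*} [DecidableEq X] [DecidableEq Y]

/-- The degree of the left vertex `x` in the bipartite graph with edge set `E`. -/
def rowDeg (E : Finset (X × Y)) (x : X) : ℕ := (E.filter fun e => e.1 = x).card

/-- The degree of the right vertex `y` in the bipartite graph with edge set `E`. -/
def colDeg (E : Finset (X × Y)) (y : Y) : ℕ := (E.filter fun e => e.2 = y).card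

/-- The number of edges in `E` between `S` and `T`. -/
def edgeCount (E : Finset (X × Y)) (S : Finset X) (T : Finset Y) : ℕ :=
  (E.filter fun e => e.1 ∈ S ∧ e.2 ∈ T).card

/-- The bipartite graph with edge set `E` is regular of degree `k`. -/
def IsBiregular (E : Finset (X × Y)) (k : ℕ) : Prop :=
  (∀ x, rowDeg E x = k) ∧ ∀ y, colDeg E y = k

lemma sum_rowDeg (E : Finset (X × Y)) (S : Finset X) :
    ∑ x ∈ S, rowDeg E x = (E.filter fun e => e.1 ∈ S).card := by
  rw [Finset.card_eq_sum_card_fiberwise (f := Prod.fst) (t := S) 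
    (by intro e he; simp only [Finset.coe_filter, Set.mem_ofPred_eq] at he; simp [he.2])]
  refine Finset.sum_congr rfl fun x hx => ?_
  rw [rowDeg, Finset.filter_filter]
  congr 1
  ext e
  simp only [Finset.mem_filter]
  constructor
  · rintro ⟨h, rfl⟩; exact ⟨h, hx, rfl⟩
  · rintro ⟨h, -, h2⟩; exact ⟨h, h2⟩

lemma sum_colDeg (E : Finset (X × Y)) (T : Finset Y) :
    ∑ y ∈ T, colDeg E y = (E.filter fun e => e.2 ∈ T).card := by
  rw [Finset.card_eq_sum_card_fiberwise (f := Prod.snd) (t := T) 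
    (by intro e he; simp only [Finset.coe_filter, Set.mem_ofPred_eq] at he; simp [he.2])]
  refine Finset.sum_congr rfl fun x hx => ?_
  rw [colDeg, Finset.filter_filter]
  congr 1
  ext e
  simp only [Finset.mem_filter]
  constructor
  · rintro ⟨h, rfl⟩; exact ⟨h, hx, rfl⟩
  · rintro ⟨h, -, h2⟩; exact ⟨h, h2⟩

lemma rowDeg_union {E F : Finset (X × Y)} (h : Disjoint E F) (x : X) :
    rowDeg (E ∪ F) x = rowDeg E x + rowDeg F x := by
  rw [rowDeg, Finset.filter_union, Finset.card_union_of_disjoint]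
  · rfl
  · exact Finset.disjoint_filter_filter h

lemma colDeg_union {E F : Finset (X × Y)} (h : Disjoint E F) (y : Y) :
    colDeg (E ∪ F) y = colDeg E y + colDeg F y := by
  rw [colDeg, Finset.filter_union, Finset.card_union_of_disjoint]
  · rfl
  · exact Finset.disjoint_filter_filter h

lemma rowDeg_sdiff {E F : Finset (X × Y)} (h : F ⊆ E) (x : X) :
    rowDeg (E \ F) x + rowDeg F x = rowDeg E x := by
  rw [← rowDeg_union Finset.sdiff_disjoint, Finset.sdiff_union_of_subset h]

lemma colDeg_sdiff {E F : Finset (X × Y)} (h : F ⊆ E) (y : Y) :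
    colDeg (E \ F) y + colDeg F y = colDeg E y := by
  rw [← colDeg_union Finset.sdiff_disjoint, Finset.sdiff_union_of_subset h]

lemma rowDeg_mono {E F : Finset (X × Y)} (h : F ⊆ E) (x : X) : rowDeg F x ≤ rowDeg E x :=
  Finset.card_le_card (Finset.filter_subset_filter _ h)

lemma colDeg_mono {E F : Finset (X × Y)} (h : F ⊆ E) (y : Y) : colDeg F y ≤ colDeg E y :=
  Finset.card_le_card (Finset.filter_subset_filter _ h)

lemma edgeCount_mono {E F : Finset (X × Y)} (h : F ⊆ E) {S S' : Finset X} (hS : S ⊆ S')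
    {T T' : Finset Y} (hT : T ⊆ T') : edgeCount F S T ≤ edgeCount E S' T' := by
  apply Finset.card_le_card
  intro e he
  simp only [Finset.mem_filter] at he ⊢
  exact ⟨h he.1, hS he.2.1, hT he.2.2⟩

lemma IsBiregular.sdiff {E F : Finset (X × Y)} {k l : ℕ} (hE : IsBiregular E (k + l))
    (hF : IsBiregular F l) (h : F ⊆ E) : IsBiregular (E \ F) k := by
  refine ⟨fun x => ?_, fun y => ?_⟩
  · have := rowDeg_sdiff h x
    rw [hE.1, hF.1] at this; omega
  · have := colDeg_sdiff h y
    rw [hE.2, hF.2] at this; omega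

variable [Fintype X] [Fintype Y]

lemma sum_rowDeg_univ (E : Finset (X × Y)) : ∑ x, rowDeg E x = E.card := by
  simp [sum_rowDeg]

lemma sum_colDeg_univ (E : Finset (X × Y)) : ∑ y, colDeg E y = E.card := by
  simp [sum_colDeg]

lemma edgeCount_add_edgeCount_compl_right (E : Finset (X × Y)) (S : Finset X) (T : Finset Y) :
    edgeCount E S T + edgeCount E S Tᶜ = ∑ x ∈ S, rowDeg E x := by
  rw [sum_rowDeg, edgeCount, edgeCount, ← Finset.card_union_of_disjoint]
  · congr 1
    ext e
    simp only [Finset.mem_union, Finset.mem_filter, Finset.mem_compl]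
    tauto
  · rw [Finset.disjoint_left]
    intro e
    simp only [Finset.mem_filter, Finset.mem_compl]
    tauto

lemma edgeCount_le_sum_colDeg (E : Finset (X × Y)) (S : Finset X) (T : Finset Y) :
    edgeCount E S T ≤ ∑ y ∈ T, colDeg E y := by
  rw [sum_colDeg]
  apply Finset.card_le_card
  intro e he
  simp only [Finset.mem_filter] at he ⊢
  exact ⟨he.1, he.2.2⟩

/-- A max-flow min-cut criterion: a bipartite graph has a spanning subgraph with prescribed degrees
as soon as no cut obstructs it. -/
theorem exists_subset_degrees_eq (E : Finset (X × Y)) (f : X → ℕ) (g : Y → ℕ)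
    (hfg : ∑ x, f x = ∑ y, g y)
    (hcut : ∀ (S : Finset X) (T : Finset Y),
      ∑ x ∈ S, f x ≤ ∑ y ∈ T, g y + edgeCount E S Tᶜ) :
    ∃ F ⊆ E, (∀ x, rowDeg F x = f x) ∧ ∀ y, colDeg F y = g y := by
  classical
  have hg : ∀ y, g y ≤ colDeg E y := by
    intro y
    -- This cut isolates y on the right: its demand must fit into the edges at y.
    have h := hcut Finset.univ ({y}ᶜ)
    rw [hfg, compl_compl] at h
    have h2 := Finset.sum_add_sum_compl {y} g
    have h3 := edgeCount_le_sum_colDeg E Finset.univ {y}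
    simp only [Finset.sum_singleton] at h2 h3
    omega
  -- Hall's theorem is applied to slots that each claim an incident edge: f x slots at x for edges
  -- to be kept, and `colDeg E y - g y` slots at y for edges to be discarded. There are as many
  -- slots as edges, so every edge is claimed and the edges claimed from the left form F.
  let t : ((Σ x, Fin (f x)) ⊕ (Σ y, Fin (colDeg E y - g y))) → Finset (X × Y) := fun s =>
    s.elim (fun a => E.filter fun e => e.1 = a.1) (fun b => E.filter fun e => e.2 = b.1)
  have hHall : ∀ s : Finset _, s.card ≤ (s.biUnion t).card := by
    intro s
    let S : Finset X := s.toLeft.image Sigma.fst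
    let T : Finset Y := s.toRight.image Sigma.fst
    have h1 : s.toLeft.card ≤ ∑ x ∈ S, f x := by
      calc s.toLeft.card ≤ (S.sigma fun x => (Finset.univ : Finset (Fin (f x)))).card := by
            apply Finset.card_le_card
            intro a ha
            simp only [Finset.mem_sigma, Finset.mem_univ, and_true]
            exact Finset.mem_image_of_mem _ ha
        _ = _ := by simp
    have h2 : s.toRight.card ≤ ∑ y ∈ T, (colDeg E y - g y) := by
      calc s.toRight.card ≤
            (T.sigma fun y => (Finset.univ : Finset (Fin (colDeg E y - g y)))).card := by
            apply Finset.card_le_card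
            intro a ha
            simp only [Finset.mem_sigma, Finset.mem_univ, and_true]
            exact Finset.mem_image_of_mem _ ha
        _ = _ := by simp
    have h3 : ∑ y ∈ T, (colDeg E y - g y) + ∑ y ∈ T, g y = ∑ y ∈ T, colDeg E y := by
      rw [← Finset.sum_add_distrib]
      exact Finset.sum_congr rfl fun y _ => Nat.sub_add_cancel (hg y)
    have h4 : edgeCount E S Tᶜ + ∑ y ∈ T, colDeg E y ≤ (s.biUnion t).card := by
      rw [sum_colDeg, edgeCount, ← Finset.card_union_of_disjoint]
      · apply Finset.card_le_card
        intro e he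
        simp only [Finset.mem_union, Finset.mem_filter, S, T, Finset.mem_compl,
          Finset.mem_image, Finset.mem_toLeft, Finset.mem_toRight] at he
        rw [Finset.mem_biUnion]
        rcases he with ⟨he, ⟨a, ha, hae⟩, -⟩ | ⟨he, ⟨b, hb, hbe⟩⟩
        · exact ⟨_, ha, by simp [t, he, hae]⟩
        · exact ⟨_, hb, by simp [t, he, hbe]⟩
      · rw [Finset.disjoint_left]
        intro e
        simp only [Finset.mem_filter, Finset.mem_compl]
        tauto
    have h5 := hcut S T
    rw [← Finset.card_toLeft_add_card_toRight (u := s)]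
    omega
  obtain ⟨φ, hφ, hφt⟩ := (Finset.all_card_le_biUnion_card_iff_exists_injective t).1 hHall
  have hφE : ∀ s, φ s ∈ E := by
    rintro (a | b)
    · exact (Finset.mem_filter.1 (hφt (Sum.inl a))).1
    · exact (Finset.mem_filter.1 (hφt (Sum.inr b))).1
  have himage : Finset.univ.image φ = E := by
    apply Finset.eq_of_subset_of_card_le
    · intro e he
      obtain ⟨s, -, rfl⟩ := Finset.mem_image.1 he
      exact hφE s
    · rw [Finset.card_image_of_injective _ hφ, Finset.card_univ, Fintype.card_sum,
        Fintype.card_sigma, Fintype.card_sigma]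
      simp only [Fintype.card_fin]
      have h3 : ∑ y, (colDeg E y - g y) + ∑ y, g y = ∑ y, colDeg E y := by
        rw [← Finset.sum_add_distrib]
        exact Finset.sum_congr rfl fun y _ => Nat.sub_add_cancel (hg y)
      rw [sum_colDeg_univ] at h3
      omega
  let F : Finset (X × Y) := Finset.univ.image fun a => φ (Sum.inl a)
  let F' : Finset (X × Y) := Finset.univ.image fun b => φ (Sum.inr b)
  have hFE : F ⊆ E := by
    intro e he
    obtain ⟨s, -, rfl⟩ := Finset.mem_image.1 he
    exact hφE _
  have hEF : E \ F = F' := by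
    ext e
    simp only [Finset.mem_sdiff, F, F', Finset.mem_image, Finset.mem_univ, true_and]
    constructor
    · rintro ⟨he, hn⟩
      rw [← himage] at he
      obtain ⟨s | s, -, rfl⟩ := Finset.mem_image.1 he
      · exact absurd ⟨s, rfl⟩ hn
      · exact ⟨s, rfl⟩
    · rintro ⟨b, rfl⟩
      refine ⟨hφE _, ?_⟩
      rintro ⟨a, ha⟩
      exact absurd (hφ ha) (by simp)
  have hrow : ∀ x, rowDeg F x = f x := by
    intro x
    have : F.filter (fun e => e.1 = x) =
        (Finset.univ : Finset (Fin (f x))).image fun i => φ (Sum.inl ⟨x, i⟩) := by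
      ext e
      simp only [F, Finset.mem_filter, Finset.mem_image, Finset.mem_univ, true_and]
      constructor
      · rintro ⟨⟨⟨x', i⟩, rfl⟩, hx⟩
        have h := (Finset.mem_filter.1 (hφt (Sum.inl ⟨x', i⟩))).2
        have heq := h.symm.trans hx
        subst heq
        exact ⟨i, rfl⟩
      · rintro ⟨i, rfl⟩
        exact ⟨⟨_, rfl⟩, (Finset.mem_filter.1 (hφt (Sum.inl ⟨x, i⟩))).2⟩
    rw [rowDeg, this, Finset.card_image_of_injective, Finset.card_univ, Fintype.card_fin]
    intro i j hij
    simpa using hφ hij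
  have hcol : ∀ y, colDeg F' y = colDeg E y - g y := by
    intro y
    have : F'.filter (fun e => e.2 = y) =
        (Finset.univ : Finset (Fin (colDeg E y - g y))).image fun i => φ (Sum.inr ⟨y, i⟩) := by
      ext e
      simp only [F', Finset.mem_filter, Finset.mem_image, Finset.mem_univ, true_and]
      constructor
      · rintro ⟨⟨⟨x', i⟩, rfl⟩, hx⟩
        have h := (Finset.mem_filter.1 (hφt (Sum.inr ⟨x', i⟩))).2
        have heq := h.symm.trans hx
        subst heq
        exact ⟨i, rfl⟩
      · rintro ⟨i, rfl⟩
        exact ⟨⟨_, rfl⟩, (Finset.mem_filter.1 (hφt (Sum.inr ⟨y, i⟩))).2⟩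
    rw [colDeg, this, Finset.card_image_of_injective, Finset.card_univ, Fintype.card_fin]
    intro i j hij
    simpa using hφ hij
  refine ⟨F, hFE, hrow, fun y => ?_⟩
  have h1 := colDeg_sdiff hFE y
  rw [hEF, hcol] at h1
  have := hg y
  omega

/-- A bipartite graph in which every degree is even has a spanning subgraph that halves all
degrees. -/
lemma exists_subset_half_degrees (E : Finset (X × Y)) (hX : ∀ x, Even (rowDeg E x))
    (hY : ∀ y, Even (colDeg E y)) :
    ∃ F ⊆ E, (∀ x, 2 * rowDeg F x = rowDeg E x) ∧ ∀ y, 2 * colDeg F y = colDeg E y := by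
  have hx : ∀ S : Finset X, 2 * ∑ x ∈ S, rowDeg E x / 2 = ∑ x ∈ S, rowDeg E x := by
    intro S
    rw [Finset.mul_sum]
    exact Finset.sum_congr rfl fun x _ => Nat.two_mul_div_two_of_even (hX x)
  have hy : ∀ T : Finset Y, 2 * ∑ y ∈ T, colDeg E y / 2 = ∑ y ∈ T, colDeg E y := by
    intro T
    rw [Finset.mul_sum]
    exact Finset.sum_congr rfl fun y _ => Nat.two_mul_div_two_of_even (hY y)
  -- Weight 1/2 on every edge is a feasible fractional flow, so no cut obstructs.
  obtain ⟨F, hF, h1, h2⟩ := exists_subset_degrees_eq E (fun x => rowDeg E x / 2)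
    (fun y => colDeg E y / 2) (by
      have h1 := hx Finset.univ
      have h2 := hy Finset.univ
      rw [sum_rowDeg_univ] at h1
      rw [sum_colDeg_univ] at h2
      omega) (by
      intro S T
      have h1 := hx S
      have h2 := hy T
      have h3 := edgeCount_add_edgeCount_compl_right E S T
      have h4 := edgeCount_le_sum_colDeg E S T
      omega)
  refine ⟨F, hF, fun x => ?_, fun y => ?_⟩
  · rw [h1, Nat.two_mul_div_two_of_even (hX x)]
  · rw [h2, Nat.two_mul_div_two_of_even (hY y)]

lemma IsBiregular.card_eq {E : Finset (X × Y)} {k : ℕ} (hE : IsBiregular E (k + 1)) :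
    Fintype.card X = Fintype.card Y := by
  have h1 := sum_rowDeg_univ E
  have h2 := sum_colDeg_univ E
  simp only [hE.1, hE.2, Finset.sum_const, Finset.card_univ, smul_eq_mul] at h1 h2
  exact Nat.eq_of_mul_eq_mul_right k.succ_pos (h1.trans h2.symm)

/-- A regular bipartite graph of positive degree has a perfect matching. -/
lemma IsBiregular.exists_perfect {E : Finset (X × Y)} {k : ℕ} (hE : IsBiregular E (k + 1)) :
    ∃ M ⊆ E, IsBiregular M 1 := by
  obtain ⟨F, hF, h1, h2⟩ := exists_subset_degrees_eq E (fun _ => 1) (fun _ => 1)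
    (by simp [hE.card_eq]) (by
      intro S T
      have h3 := edgeCount_add_edgeCount_compl_right E S T
      have h4 := edgeCount_le_sum_colDeg E S T
      simp only [hE.1, hE.2, Finset.sum_const, smul_eq_mul, mul_one] at h3 h4 ⊢
      by_contra! hlt
      have h5 : S.card * (k + 1) ≤ T.card * (k + 1) + edgeCount E S Tᶜ := by omega
      have h6 : (T.card + edgeCount E S Tᶜ + 1) * (k + 1) ≤ S.card * (k + 1) :=
        Nat.mul_le_mul_right _ hlt
      nlinarith [Nat.zero_le (edgeCount E S Tᶜ * k)])
  exact ⟨F, hF, h1, h2⟩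

/-- `𝓜` consists of pairwise disjoint perfect matchings with union `E`. -/
def IsOneFactorization (𝓜 : Finset (Finset (X × Y))) (E : Finset (X × Y)) : Prop :=
  (∀ M ∈ 𝓜, IsBiregular M 1) ∧ (∀ M ∈ 𝓜, ∀ M' ∈ 𝓜, M ≠ M' → Disjoint M M') ∧ 𝓜.sup id = E

/-- König: a `k`-regular bipartite graph has a decomposition into `k` perfect matchings. -/
theorem IsBiregular.exists_oneFactorization [Nonempty X] {k : ℕ} {E : Finset (X × Y)}
    (hE : IsBiregular E k) : ∃ 𝓜 : Finset (Finset (X × Y)), 𝓜.card = k ∧ IsOneFactorization 𝓜 E := by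
  induction k generalizing E with
  | zero =>
    refine ⟨∅, rfl, by simp, by simp, ?_⟩
    have := sum_rowDeg_univ E
    simp only [hE.1, Finset.sum_const_zero] at this
    simpa using (Finset.card_eq_zero.1 this.symm).symm
  | succ k ih =>
    obtain ⟨M, hME, hM⟩ := hE.exists_perfect
    obtain ⟨𝓜, hcard, h1, h2, h3⟩ := ih (hE.sdiff hM hME)
    have hdis : ∀ M' ∈ 𝓜, Disjoint M M' := by
      intro M' hM'
      have : M' ⊆ E \ M := h3 ▸ Finset.le_sup (f := id) hM'
      exact Finset.disjoint_of_subset_right this Finset.disjoint_sdiff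
    -- A matching disjoint from itself is empty, which is impossible when there is a vertex; hence
    -- the cardinality really grows by one.
    have hnot : M ∉ 𝓜 := by
      intro h
      have h0 := hdis M h
      rw [disjoint_self] at h0
      obtain ⟨x⟩ := ‹Nonempty X›
      have := hM.1 x
      rw [h0] at this
      simp [rowDeg] at this
    refine ⟨insert M 𝓜, by rw [Finset.card_insert_of_notMem hnot, hcard], ?_, ?_, ?_⟩
    · intro M' hM'
      rcases Finset.mem_insert.1 hM' with rfl | h
      exacts [hM, h1 _ h]
    · intro A hA B hB hAB
      rcases Finset.mem_insert.1 hA with rfl | hA' <;> rcases Finset.mem_insert.1 hB with rfl | hB'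
      exacts [absurd rfl hAB, hdis _ hB', (hdis _ hA').symm, h2 _ hA' _ hB' hAB]
    · rw [Finset.sup_insert, h3]
      simpa using hME

/-- If the multigraph obtained by doubling the edges of `F` is `Δ`-regular, and a matching avoiding
`F` fixes the parity of `Δ`, then two one-factorizations with `Δ` members in total cover `E`. -/
theorem exists_cover_of_doubling [Nonempty X] {E F M : Finset (X × Y)} {Δ ε : ℕ} (hF : F ⊆ E)
    (hM : M ⊆ E) (hFM : Disjoint F M) (hMε : IsBiregular M ε) (hε : Even (Δ + ε))
    (hrow : ∀ x, rowDeg F x + rowDeg E x = Δ) (hcol : ∀ y, colDeg F y + colDeg E y = Δ) :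
    ∃ (𝓜₁ 𝓜₂ : Finset (Finset (X × Y))) (E₁ E₂ : Finset (X × Y)), IsOneFactorization 𝓜₁ E₁ ∧
      IsOneFactorization 𝓜₂ E₂ ∧ E₁ ∪ E₂ = E ∧ 𝓜₁.card + 𝓜₂.card = Δ := by
  have hsub : F ∪ M ⊆ E := Finset.union_subset hF hM
  have hr : ∀ x, rowDeg (E \ (F ∪ M)) x + (rowDeg F x + ε) = rowDeg E x := by
    intro x
    rw [← rowDeg_sdiff hsub x, rowDeg_union hFM, hMε.1]
  have hc : ∀ y, colDeg (E \ (F ∪ M)) y + (colDeg F y + ε) = colDeg E y := by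
    intro y
    rw [← colDeg_sdiff hsub y, colDeg_union hFM, hMε.2]
  obtain ⟨a, ha⟩ := hε
  -- With 2a = Δ + ε, the remaining degree deg_E - deg_F - ε equals 2(deg_E - a).
  obtain ⟨A, hA, hA1, hA2⟩ := exists_subset_half_degrees (E \ (F ∪ M))
    (fun x => ⟨rowDeg E x - a, by have := hr x; have := hrow x; omega⟩)
    (fun y => ⟨colDeg E y - a, by have := hc y; have := hcol y; omega⟩)
  have hdA : Disjoint (F ∪ M) A := Finset.disjoint_of_subset_right hA Finset.disjoint_sdiff
  have hd2 : Disjoint F ((E \ (F ∪ M)) \ A) :=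
    Finset.disjoint_of_subset_right (Finset.sdiff_subset)
      (Finset.disjoint_of_subset_left Finset.subset_union_left Finset.disjoint_sdiff)
  have hreg1 : IsBiregular ((F ∪ M) ∪ A) a := by
    refine ⟨fun x => ?_, fun y => ?_⟩
    · rw [rowDeg_union hdA, rowDeg_union hFM, hMε.1]
      have := hr x; have := hrow x; have := hA1 x
      omega
    · rw [colDeg_union hdA, colDeg_union hFM, hMε.2]
      have := hc y; have := hcol y; have := hA2 y
      omega
  obtain ⟨𝓜₁, c1, f1⟩ := hreg1.exists_oneFactorization
  have hreg2 : IsBiregular (F ∪ ((E \ (F ∪ M)) \ A)) (Δ - a) := by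
    refine ⟨fun x => ?_, fun y => ?_⟩
    · rw [rowDeg_union hd2]
      have := hr x; have := hrow x; have := hA1 x; have := rowDeg_sdiff hA x
      omega
    · rw [colDeg_union hd2]
      have := hc y; have := hcol y; have := hA2 y; have := colDeg_sdiff hA y
      omega
  obtain ⟨𝓜₂, c2, f2⟩ := hreg2.exists_oneFactorization
  refine ⟨𝓜₁, 𝓜₂, _, _, f1, f2, ?_, ?_⟩
  · ext e
    have hAe := @hA e
    have hFe := @hF e
    have hMe := @hM e
    simp only [Finset.mem_union, Finset.mem_sdiff] at hAe ⊢
    tauto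
  · obtain ⟨x⟩ := ‹Nonempty X›
    have := hr x; have := hrow x
    omega

end BipartiteEdgeSets

/-! ### Pseudorandom bipartite graphs and their cut conditions. -/

section Deterministic

variable {α : Type*} [DecidableEq α] [Fintype α]

/-- The bipartite graph `E` with its two sides exchanged. -/
def swapEdges (E : Finset (α × α)) : Finset (α × α) := E.map (Equiv.prodComm α α).toEmbedding

@[simp] lemma mem_swapEdges {E : Finset (α × α)} {e : α × α} : e ∈ swapEdges E ↔ e.swap ∈ E := by
  simp only [swapEdges, Finset.mem_map, Equiv.coe_toEmbedding, Equiv.prodComm_apply]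
  constructor
  · rintro ⟨a, ha, rfl⟩; simpa using ha
  · intro h; exact ⟨_, h, by simp⟩

@[simp] lemma swapEdges_swapEdges (E : Finset (α × α)) : swapEdges (swapEdges E) = E := by
  ext e; simp

lemma card_filter_swapEdges (E : Finset (α × α)) (q : α × α → Prop) [DecidablePred q] :
    ((swapEdges E).filter q).card = (E.filter fun e => q e.swap).card := by
  rw [swapEdges, Finset.filter_map, Finset.card_map]
  rfl

@[simp] lemma card_swapEdges (E : Finset (α × α)) : (swapEdges E).card = E.card := by
  simp [swapEdges]

@[simp] lemma rowDeg_swapEdges (E : Finset (α × α)) (x : α) :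
    rowDeg (swapEdges E) x = colDeg E x := card_filter_swapEdges _ _

@[simp] lemma colDeg_swapEdges (E : Finset (α × α)) (x : α) :
    colDeg (swapEdges E) x = rowDeg E x := card_filter_swapEdges _ _

@[simp] lemma edgeCount_swapEdges (E : Finset (α × α)) (S T : Finset α) :
    edgeCount (swapEdges E) S T = edgeCount E T S := by
  rw [edgeCount, card_filter_swapEdges, edgeCount]
  congr 1
  ext e
  simp [and_comm]

lemma swapEdges_sdiff (E F : Finset (α × α)) :
    swapEdges (E \ F) = swapEdges E \ swapEdges F := by
  ext e; simp

/-- The properties of the random bipartite graph that concern its edges between sets and the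
degrees on the left, with `r ^ 2` the average degree and `L` the logarithm of the order. -/
structure IsRowPseudorandom (E : Finset (α × α)) (p L r : ℝ) : Prop where
  abs_rowDeg_sub_le : ∀ x, |(rowDeg E x : ℝ) - r ^ 2| ≤ r * L
  edgeCount_le : ∀ S T : Finset α,
    (edgeCount E S T : ℝ) ≤ 2 * p * S.card * T.card + 4 * (S.card + T.card) * L
  le_edgeCount : ∀ S T : Finset α, 128 * L ≤ p * S.card → 128 * L ≤ p * T.card →
    p * S.card * T.card / 2 ≤ edgeCount E S T
  card_le : (E.card : ℝ) ≤ Fintype.card α * (r ^ 2 + r / 16)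
  exists_le_rowDeg : ∃ x, r ^ 2 + r / 8 ≤ rowDeg E x
  sum_colDeg_le : ∀ x, (∑ e ∈ E.filter (fun e => e.1 = x), colDeg E e.2 : ℝ) ≤
    rowDeg E x * (r ^ 2 + 1 + r / 16)

/-- The two-sided version of `IsRowPseudorandom`. -/
def IsPseudorandom (E : Finset (α × α)) (p L r : ℝ) : Prop :=
  IsRowPseudorandom E p L r ∧ IsRowPseudorandom (swapEdges E) p L r

lemma IsPseudorandom.swap {E : Finset (α × α)} {p L r : ℝ} (h : IsPseudorandom E p L r) :
    IsPseudorandom (swapEdges E) p L r := ⟨h.2, by rw [swapEdges_swapEdges]; exact h.1⟩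

/-- Each vertex has many neighbours of positive demand. -/
lemma le_card_neighbors_of_demand_pos {E G : Finset (α × α)} {p L r : ℝ}
    (hE : IsRowPseudorandom E p L r) (hL : 1000 ≤ L) (hr : 1000000 * L ^ 3 ≤ r) {Δ : ℕ}
    (hΔ : r ^ 2 + r / 8 ≤ Δ) {g : α → ℕ} (hg : ∀ y, (g y : ℝ) ≤ 3 * r * L)
    (hgΔ : ∀ y, Δ ≤ g y + colDeg E y) (hGE : G ⊆ E) {x : α} (hx : rowDeg E x ≤ rowDeg G x + 2) :
    r ^ 2 / (256 * L) ≤ (G.filter fun e => e.1 = x ∧ 1 ≤ g e.2).card := by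
  have hL0 : 0 < L := by linarith
  have hL2 : 1000000 ≤ L ^ 2 := by nlinarith
  have hLr : 1000000000000 * L ≤ r := by nlinarith
  have hr0 : 0 < r := by linarith
  -- The neighbours of x have average demand at least r/8 - r/16 - 1, hence at least r/32. As no
  -- demand exceeds 3rL, a proportion of order 1/L of them has positive demand.
  have h1 : (rowDeg E x : ℝ) * (r / 32) ≤
      ∑ e ∈ E.filter (fun e => e.1 = x), (g e.2 : ℝ) := by
    have h2 : ∑ e ∈ E.filter (fun e => e.1 = x), ((Δ : ℝ) - colDeg E e.2) ≤
        ∑ e ∈ E.filter (fun e => e.1 = x), (g e.2 : ℝ) := by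
      apply Finset.sum_le_sum
      intro e _
      have : (Δ : ℝ) ≤ g e.2 + colDeg E e.2 := by exact_mod_cast hgΔ e.2
      linarith
    rw [Finset.sum_sub_distrib, Finset.sum_const, nsmul_eq_mul] at h2
    have h3 := hE.sum_colDeg_le x
    have h4 : (rowDeg E x : ℝ) * (r ^ 2 + r / 8) ≤ rowDeg E x * Δ := by gcongr
    have h5 : (rowDeg E x : ℝ) * 1 ≤ rowDeg E x * (r / 32) := by gcongr; linarith
    change (rowDeg E x : ℝ) * Δ - _ ≤ _ at h2
    nlinarith
  have h2 : ∑ e ∈ E.filter (fun e => e.1 = x), (g e.2 : ℝ) ≤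
      (E.filter fun e => e.1 = x ∧ 1 ≤ g e.2).card * (3 * r * L) := by
    have hzero : ∑ e ∈ (E.filter fun e => e.1 = x).filter (fun e => ¬ 1 ≤ g e.2), (g e.2 : ℝ)
        = 0 := by
      refine Finset.sum_eq_zero fun e he => ?_
      have := (Finset.mem_filter.1 he).2
      have : g e.2 = 0 := by omega
      simp [this]
    rw [← Finset.sum_filter_add_sum_filter_not _ (fun e => 1 ≤ g e.2), hzero,
      Finset.filter_filter, add_zero, ← nsmul_eq_mul]
    exact Finset.sum_le_card_nsmul _ _ _ fun e _ => hg e.2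
  have h3 : (E.filter fun e => e.1 = x ∧ 1 ≤ g e.2).card ≤
      (G.filter fun e => e.1 = x ∧ 1 ≤ g e.2).card + 2 := by
    have hsd := rowDeg_sdiff hGE x
    have h4 : (E.filter fun e => e.1 = x ∧ 1 ≤ g e.2) ⊆
        (G.filter fun e => e.1 = x ∧ 1 ≤ g e.2) ∪ ((E \ G).filter fun e => e.1 = x) := by
      intro e he
      simp only [Finset.mem_filter, Finset.mem_union, Finset.mem_sdiff] at he ⊢
      tauto
    have h5 := (Finset.card_le_card h4).trans (Finset.card_union_le _ _)
    change _ ≤ _ + rowDeg (E \ G) x at h5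
    omega
  have h3' : ((E.filter fun e => e.1 = x ∧ 1 ≤ g e.2).card : ℝ) ≤
      (G.filter fun e => e.1 = x ∧ 1 ≤ g e.2).card + 2 := by exact_mod_cast h3
  have h6 := (abs_le.1 (hE.abs_rowDeg_sub_le x)).1
  have h7 : r ^ 2 / 2 ≤ rowDeg E x := by nlinarith
  set c : ℝ := ((G.filter fun e => e.1 = x ∧ 1 ≤ g e.2).card : ℝ)
  have h8 : r ^ 2 / 2 * (r / 32) ≤ (c + 2) * (3 * r * L) := by
    calc r ^ 2 / 2 * (r / 32) ≤ rowDeg E x * (r / 32) := by gcongr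
      _ ≤ _ := h1.trans h2
      _ ≤ _ := by gcongr
  have h9 : r ^ 2 / 64 ≤ (c + 2) * (3 * L) := by
    have : r * (r ^ 2 / 64) ≤ r * ((c + 2) * (3 * L)) := by nlinarith
    exact le_of_mul_le_mul_left this hr0
  rw [div_le_iff₀ (by positivity)]
  nlinarith

/-- The cut condition for cuts that are small on the left. -/
lemma cut_le_of_small {E G : Finset (α × α)} {p L r : ℝ} (hE : IsRowPseudorandom E p L r)
    (hp : 0 < p) (hL : 1000 ≤ L) (hr : 1000000 * L ^ 3 ≤ r) {f g : α → ℕ}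
    (hf : ∀ x, (f x : ℝ) ≤ 3 * r * L) (hGE : G ⊆ E) {S : Finset α}
    (hS : ∀ x ∈ S, r ^ 2 / (256 * L) ≤ (G.filter fun e => e.1 = x ∧ 1 ≤ g e.2).card)
    (hsmall : 3072 * p * L ^ 2 * S.card ≤ r) (T : Finset α) :
    ∑ x ∈ S, f x ≤ ∑ y ∈ T, g y + edgeCount G S Tᶜ := by
  rcases S.eq_empty_or_nonempty with rfl | hne
  · simp
  have hs : (0 : ℝ) < S.card := by exact_mod_cast hne.card_pos
  have hL0 : 0 < L := by linarith
  have hr0 : 0 < r := by nlinarith [pow_pos hL0 3]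
  let U : Finset α := Finset.univ.filter fun y => 1 ≤ g y ∧ ∃ x ∈ S, (x, y) ∈ G
  -- A vertex of U contributes its demand if it lies in T, and an edge from S otherwise.
  have h1 : U.card ≤ ∑ y ∈ T, g y + edgeCount G S Tᶜ := by
    rw [← Finset.card_filter_add_card_filter_not (s := U) (fun y => y ∈ T)]
    apply add_le_add
    · calc (U.filter fun y => y ∈ T).card = ∑ y ∈ U.filter (fun y => y ∈ T), 1 := by simp
        _ ≤ ∑ y ∈ U.filter (fun y => y ∈ T), g y := by
          apply Finset.sum_le_sum
          intro y hy
          exact (Finset.mem_filter.1 (Finset.mem_filter.1 hy).1).2.1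
        _ ≤ ∑ y ∈ T, g y := Finset.sum_le_sum_of_subset fun y hy => (Finset.mem_filter.1 hy).2
    · have : (U.filter fun y => ¬ y ∈ T) ⊆
          (G.filter fun e => e.1 ∈ S ∧ e.2 ∈ Tᶜ).image Prod.snd := by
        intro y hy
        simp only [Finset.mem_filter, U, Finset.mem_univ, true_and] at hy
        obtain ⟨⟨-, x, hx, hxy⟩, hyT⟩ := hy
        exact Finset.mem_image.2 ⟨(x, y), by simp [hx, hxy, hyT], rfl⟩
      exact (Finset.card_le_card this).trans Finset.card_image_le
  have h2 : (S.card : ℝ) * (r ^ 2 / (256 * L)) ≤ edgeCount E S U := by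
    have h3 : ∑ x ∈ S, (G.filter fun e => e.1 = x ∧ 1 ≤ g e.2).card ≤ edgeCount E S U := by
      rw [← Finset.card_biUnion]
      · apply Finset.card_le_card
        intro e he
        simp only [Finset.mem_biUnion, Finset.mem_filter] at he
        obtain ⟨x, hx, heG, rfl, hg⟩ := he
        simp only [Finset.mem_filter, U, Finset.mem_univ, true_and]
        exact ⟨hGE heG, hx, hg, e.1, hx, heG⟩
      · intro x _ x' _ hxx'
        rw [Function.onFun, Finset.disjoint_left]
        intro e he he'
        exact hxx' ((Finset.mem_filter.1 he).2.1.symm.trans (Finset.mem_filter.1 he').2.1)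
    calc (S.card : ℝ) * (r ^ 2 / (256 * L)) = ∑ x ∈ S, r ^ 2 / (256 * L) := by simp
      _ ≤ ∑ x ∈ S, ((G.filter fun e => e.1 = x ∧ 1 ≤ g e.2).card : ℝ) := Finset.sum_le_sum hS
      _ ≤ _ := by exact_mod_cast h3
  refine le_trans ?_ h1
  -- If U were smaller than the demand of S, it would be too small to receive all the edges that S
  -- sends to it.
  by_contra! hlt
  have h4 : ((∑ x ∈ S, f x : ℕ) : ℝ) ≤ S.card * (3 * r * L) := by
    push_cast
    calc ∑ x ∈ S, (f x : ℝ) ≤ S.card • (3 * r * L) := Finset.sum_le_card_nsmul _ _ _ fun x _ => hf x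
      _ = _ := nsmul_eq_mul _ _
  have h5 : (U.card : ℝ) ≤ S.card * (3 * r * L) := by
    have : (U.card : ℝ) ≤ ((∑ x ∈ S, f x : ℕ) : ℝ) := by exact_mod_cast hlt.le
    linarith
  have h6 := hE.edgeCount_le S U
  set s : ℝ := (S.card : ℝ)
  set u : ℝ := (U.card : ℝ)
  have h7 : s * (r ^ 2 / (256 * L)) ≤ s * (2 * p * (s * (3 * r * L)) + 4 * (1 + 3 * r * L) * L) := by
    calc s * (r ^ 2 / (256 * L)) ≤ 2 * p * s * u + 4 * (s + u) * L := h2.trans h6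
      _ ≤ 2 * p * s * (s * (3 * r * L)) + 4 * (s + s * (3 * r * L)) * L := by gcongr
      _ = _ := by ring
  have h8 := le_of_mul_le_mul_left h7 hs
  rw [div_le_iff₀ (by positivity)] at h8
  -- The term 2p·s·3rL, multiplied by 256L, is 1536 p s r L²; the threshold 3072 makes this at most
  -- r²/2.
  have h9 : p * s * L ^ 2 * 3072 * r ≤ r * r := by nlinarith
  have h10 : 1 ≤ r * L := by nlinarith [pow_pos hL0 3, pow_le_pow_left₀ (by norm_num) hL 3]
  have h11 : 1000000 * L ^ 3 * r ≤ r * r := by gcongr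
  have h12 : 4 * (1 + 3 * r * L) * L * (256 * L) ≤ 4 * (4 * (r * L)) * L * (256 * L) := by
    gcongr; linarith
  nlinarith

/-- The cut condition for cuts that are large on both sides. -/
lemma cut_le_of_large {E G : Finset (α × α)} {p L r N : ℝ} (hE : IsRowPseudorandom E p L r)
    (hp : 0 < p) (hN : N * p = r ^ 2) (hL : 1000 ≤ L) (hr : 1000000 * L ^ 3 ≤ r) {f g : α → ℕ}
    (hf : ∀ x, (f x : ℝ) ≤ 3 * r * L) (hg : ∀ y, (g y : ℝ) ≤ 3 * r * L)
    (hfg : ∑ x, f x = ∑ y, g y) (htotal : N * (r / 16) ≤ ∑ x, (f x : ℝ)) {S T : Finset α}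
    (hS : r ≤ 3072 * p * L ^ 2 * S.card) (hT : r ≤ 3072 * p * L ^ 2 * T.card)
    (hES : edgeCount E S T ≤ edgeCount G S T + S.card)
    (hET : edgeCount E S T ≤ edgeCount G S T + T.card) :
    ∑ x ∈ S, f x + ∑ y ∈ T, g y ≤ ∑ x, f x + edgeCount G S T := by
  have hL0 : 0 < L := by linarith
  have hL3 : 0 < L ^ 3 := pow_pos hL0 3
  have hr0 : 0 < r := by linarith
  have key : ∀ s : ℝ, r ≤ 3072 * p * L ^ 2 * s → 128 * L ≤ p * s := by
    intro s hs
    have : (3072 * L ^ 2) * (128 * L) ≤ (3072 * L ^ 2) * (p * s) := by nlinarith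
    exact le_of_mul_le_mul_left this (by positivity)
  have hlow := hE.le_edgeCount S T (key _ hS) (key _ hT)
  have hSf : ∑ x ∈ S, f x ≤ ∑ x, f x := Finset.sum_le_univ_sum_of_nonneg fun _ => Nat.zero_le _
  have hTg : ∑ y ∈ T, g y ≤ ∑ x, f x :=
    hfg ▸ Finset.sum_le_univ_sum_of_nonneg fun _ => Nat.zero_le _
  have hSf' : ((∑ x ∈ S, f x : ℕ) : ℝ) ≤ S.card * (3 * r * L) := by
    push_cast
    calc ∑ x ∈ S, (f x : ℝ) ≤ S.card • (3 * r * L) := Finset.sum_le_card_nsmul _ _ _ fun x _ => hf x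
      _ = _ := nsmul_eq_mul _ _
  have hTg' : ((∑ y ∈ T, g y : ℕ) : ℝ) ≤ T.card * (3 * r * L) := by
    push_cast
    calc ∑ y ∈ T, (g y : ℝ) ≤ T.card • (3 * r * L) := Finset.sum_le_card_nsmul _ _ _ fun x _ => hg x
      _ = _ := nsmul_eq_mul _ _
  have hES' : (edgeCount E S T : ℝ) ≤ edgeCount G S T + S.card := by exact_mod_cast hES
  have hET' : (edgeCount E S T : ℝ) ≤ edgeCount G S T + T.card := by exact_mod_cast hET
  have hs0 : (0 : ℝ) ≤ S.card := Nat.cast_nonneg _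
  have ht0 : (0 : ℝ) ≤ T.card := Nat.cast_nonneg _
  have hrL : 1 ≤ r * L := by nlinarith [pow_le_pow_left₀ (by norm_num) hL 3]
  -- Here each vertex of T accounts on average for 8rL edges from S, more than its demand and its
  -- lost edge together.
  by_cases h1 : 16 * r * L ≤ p * S.card
  · have h2 : (16 * r * L) * T.card ≤ p * S.card * T.card := by gcongr
    have h3 : ((∑ y ∈ T, g y : ℕ) : ℝ) ≤ edgeCount G S T := by nlinarith
    have h4 : ∑ y ∈ T, g y ≤ edgeCount G S T := by exact_mod_cast h3
    omega
  by_cases h2 : 16 * r * L ≤ p * T.card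
  · have h2 : (16 * r * L) * S.card ≤ p * T.card * S.card := by gcongr
    have h3 : ((∑ x ∈ S, f x : ℕ) : ℝ) ≤ edgeCount G S T := by nlinarith
    have h4 : ∑ x ∈ S, f x ≤ edgeCount G S T := by exact_mod_cast h3
    omega
  push Not at h1 h2
  -- Both sets now have fewer than 16rL/p vertices, so their demands add up to at most 96r²L²/p,
  -- below the total demand, which is at least r³/(16p). No edges are needed.
  have h3 : p * (((∑ x ∈ S, f x : ℕ) : ℝ) + ((∑ y ∈ T, g y : ℕ) : ℝ)) ≤
      p * ((∑ x, f x : ℕ) : ℝ) := by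
    push_cast at hSf' hTg' ⊢
    have h4 : p * (N * (r / 16)) ≤ p * ∑ x, (f x : ℝ) := by gcongr
    have h5 : p * (∑ x ∈ S, (f x : ℝ)) ≤ p * (S.card * (3 * r * L)) := by gcongr
    have h6 : p * (∑ x ∈ T, (g x : ℝ)) ≤ p * (T.card * (3 * r * L)) := by gcongr
    have h7 : p * S.card * (3 * r * L) ≤ 16 * r * L * (3 * r * L) := by gcongr
    have h8 : p * T.card * (3 * r * L) ≤ 16 * r * L * (3 * r * L) := by gcongr
    have h9 : p * (N * (r / 16)) = r ^ 2 * (r / 16) := by rw [← hN]; ring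
    have h10 : r ^ 2 * (1536 * L ^ 2) ≤ r ^ 2 * r := by
      gcongr
      nlinarith [pow_pos hL0 2]
    nlinarith
  have h4 := le_of_mul_le_mul_left h3 hp
  have h5 : ∑ x ∈ S, f x + ∑ y ∈ T, g y ≤ ∑ x, f x := by exact_mod_cast h4
  omega

/-- The cut condition for a perfect matching, for cuts with the smaller part on the left. -/
lemma card_le_edgeCount_of_card_add_card {E E' : Finset (α × α)} {p L r : ℝ}
    (hE : IsRowPseudorandom E p L r) (hp : 0 < p) (hN : Fintype.card α * p = r ^ 2) (hL : 1000 ≤ L)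
    (hr : 1000000 * L ^ 3 ≤ r) (hE' : E' ⊆ E) (hcard : ((E \ E').card : ℝ) ≤ 2 * r * L)
    (hdeg : ∀ x, r ^ 2 / 2 ≤ rowDeg E' x) {S T : Finset α} (hST : S.card ≤ T.card)
    (hsum : Fintype.card α ≤ S.card + T.card) : S.card ≤ edgeCount E' S T := by
  rcases S.eq_empty_or_nonempty with rfl | hne
  · simp
  have hs : (1 : ℝ) ≤ S.card := by exact_mod_cast hne.card_pos
  have hL0 : 0 < L := by linarith
  have hL3 : 0 < L ^ 3 := pow_pos hL0 3
  have hr0 : 0 < r := by linarith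
  have hT : (Fintype.card α : ℝ) ≤ 2 * T.card := by
    have : Fintype.card α ≤ 2 * T.card := by omega
    exact_mod_cast this
  have hT2 : r ^ 2 ≤ 2 * (p * T.card) := by rw [← hN]; nlinarith
  have hL2 : 1000000 ≤ L ^ 2 := by nlinarith
  have hLr : 1000000000000 * L ≤ r := by nlinarith
  have hrr : 1000000000000 * (r * L) ≤ r ^ 2 := by nlinarith
  have h1 : 1 ≤ r * L := by nlinarith
  -- For large S, the at least r²|S|/4 edges of E between S and T far outnumber the deleted ones.
  -- For small S, few of its edges can end in the complement of T, which is no larger than S, so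
  -- most of them reach T.
  by_cases h : 128 * L ≤ p * S.card
  · have h2 := hE.le_edgeCount S T h (by nlinarith)
    have h3 : edgeCount E S T ≤ edgeCount E' S T + (E \ E').card := by
      have : (E.filter fun e => e.1 ∈ S ∧ e.2 ∈ T) ⊆
          (E'.filter fun e => e.1 ∈ S ∧ e.2 ∈ T) ∪ (E \ E') := by
        intro e he
        simp only [Finset.mem_filter, Finset.mem_union, Finset.mem_sdiff] at he ⊢
        tauto
      exact (Finset.card_le_card this).trans (Finset.card_union_le _ _)
    have h3' : (edgeCount E S T : ℝ) ≤ edgeCount E' S T + (E \ E').card := by exact_mod_cast h3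
    have h4 : r ^ 2 * S.card ≤ 2 * (p * T.card) * S.card := by gcongr
    have h5 : 1000000000000 * (r * L) * S.card ≤ r ^ 2 * S.card := by gcongr
    have h6 : r * L * 1 ≤ r * L * S.card := by gcongr
    have h7 : 1 * (S.card : ℝ) ≤ r * L * S.card := by gcongr
    have : (S.card : ℝ) ≤ edgeCount E' S T := by nlinarith
    exact_mod_cast this
  · push Not at h
    have h2 := edgeCount_add_edgeCount_compl_right E' S T
    have h2' : (edgeCount E' S T : ℝ) + edgeCount E' S Tᶜ = ∑ x ∈ S, (rowDeg E' x : ℝ) := by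
      exact_mod_cast h2
    have h3 : (S.card : ℝ) * (r ^ 2 / 2) ≤ ∑ x ∈ S, (rowDeg E' x : ℝ) := by
      rw [← nsmul_eq_mul]
      exact Finset.card_nsmul_le_sum _ _ _ fun x _ => hdeg x
    have h4 : (edgeCount E' S Tᶜ : ℝ) ≤ edgeCount E S Tᶜ := by
      exact_mod_cast edgeCount_mono hE' subset_rfl subset_rfl
    have h5 := hE.edgeCount_le S Tᶜ
    have h6 : ((Tᶜ).card : ℝ) ≤ S.card := by
      rw [Finset.card_compl]
      exact_mod_cast (by omega : Fintype.card α - T.card ≤ S.card)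
    have h7 : (edgeCount E S Tᶜ : ℝ) ≤ 2 * p * S.card * S.card + 4 * (S.card + S.card) * L :=
      h5.trans (by gcongr)
    have h8 : p * S.card * S.card ≤ 128 * L * S.card := by gcongr
    have h9 : (1 + 264 * L) * S.card ≤ r ^ 2 / 2 * S.card := by gcongr; nlinarith
    have : (S.card : ℝ) ≤ edgeCount E' S T := by nlinarith
    exact_mod_cast this

end Deterministic

/-! ### Deleting edges at a vertex of largest degree. -/

section Deletion

variable {α : Type*} [DecidableEq α] [Fintype α]

/-- `E'` arises from `E` by deleting edges at `v`, and `v` has the largest degree `Δ` in `E'`. -/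
structure IsVertexDeletion (E E' : Finset (α × α)) (v : α ⊕ α) (Δ : ℕ) : Prop where
  subset : E' ⊆ E
  eq_or_eq : ∀ e ∈ E \ E', Sum.inl e.1 = v ∨ Sum.inr e.2 = v
  degree_eq : v.elim (rowDeg E') (colDeg E') = Δ
  rowDeg_le : ∀ x, rowDeg E' x ≤ Δ
  colDeg_le : ∀ y, colDeg E' y ≤ Δ

namespace IsVertexDeletion

variable {E E' : Finset (α × α)} {v : α ⊕ α} {Δ : ℕ} {p L r : ℝ}

lemma swap (h : IsVertexDeletion E E' v Δ) :
    IsVertexDeletion (swapEdges E) (swapEdges E') v.swap Δ where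
  subset e he := by
    rw [mem_swapEdges] at he ⊢
    exact h.subset he
  eq_or_eq e he := by
    rw [← swapEdges_sdiff, mem_swapEdges] at he
    rcases h.eq_or_eq _ he with h | h
    · right; rw [← h]; rfl
    · left; rw [← h]; rfl
  degree_eq := by
    rw [← h.degree_eq]
    cases v <;> simp
  rowDeg_le x := by simpa using h.colDeg_le x
  colDeg_le x := by simpa using h.rowDeg_le x

/-- Every deleted edge at x joins x to v, and there is at most one such edge. -/
lemma rowDeg_le_add_one (h : IsVertexDeletion E E' v Δ) {x : α} (hx : Sum.inl x ≠ v) :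
    rowDeg E x ≤ rowDeg E' x + 1 := by
  have h1 := rowDeg_sdiff h.subset x
  have h2 : rowDeg (E \ E') x ≤ 1 := by
    apply Finset.card_le_one.2
    intro a ha b hb
    rw [Finset.mem_filter] at ha hb
    rcases h.eq_or_eq a ha.1 with h3 | h3
    · exact absurd (ha.2 ▸ h3) hx
    rcases h.eq_or_eq b hb.1 with h4 | h4
    · exact absurd (hb.2 ▸ h4) hx
    exact Prod.ext (ha.2.trans hb.2.symm) (Sum.inr_injective (h3.trans h4.symm))
  omega

/-- The number of deleted edges is the old degree of v minus Δ, and the old degree is at most r² +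
rL. -/
lemma le_and_card_le_of_inl (h : IsVertexDeletion E E' v Δ) (hE : IsRowPseudorandom E p L r) {x : α}
    (hx : v = Sum.inl x) :
    (Δ : ℝ) ≤ r ^ 2 + r * L ∧ ((E \ E').card : ℝ) ≤ r ^ 2 + r * L - Δ := by
  have h0 : rowDeg E' x = Δ := by rw [← h.degree_eq, hx]; rfl
  have h1 := (abs_le.1 (hE.abs_rowDeg_sub_le x)).2
  have h2 : (E \ E').card = rowDeg (E \ E') x := by
    rw [rowDeg, Finset.filter_true_of_mem]
    intro e he
    rcases h.eq_or_eq e he with h3 | h3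
    · exact Sum.inl_injective (h3.trans hx)
    · exact absurd (h3.trans hx) (by simp)
  have h3 := rowDeg_sdiff h.subset x
  have h4 : ((E \ E').card : ℝ) + Δ = rowDeg E x := by rw [h2, ← h0]; exact_mod_cast h3
  have h5 : (0 : ℝ) ≤ (E \ E').card := Nat.cast_nonneg _
  constructor <;> linarith

lemma le_and_card_le (h : IsVertexDeletion E E' v Δ) (hE : IsPseudorandom E p L r) :
    (Δ : ℝ) ≤ r ^ 2 + r * L ∧ ((E \ E').card : ℝ) ≤ r ^ 2 + r * L - Δ := by
  rcases v with x | y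
  · exact h.le_and_card_le_of_inl hE.1 rfl
  · have := h.swap.le_and_card_le_of_inl hE.2 (x := y) rfl
    rwa [← swapEdges_sdiff, card_swapEdges] at this

lemma le_rowDeg (h : IsVertexDeletion E E' v Δ) (hE : IsPseudorandom E p L r)
    (hΔ : r ^ 2 ≤ Δ) (hrL : 0 ≤ r * L) (x : α) : r ^ 2 - r * L - 1 ≤ rowDeg E' x := by
  by_cases hx : Sum.inl x = v
  · have : rowDeg E' x = Δ := by rw [← h.degree_eq, ← hx]; rfl
    rw [this]
    linarith
  · have h1 := (abs_le.1 (hE.1.abs_rowDeg_sub_le x)).1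
    have h2 : (rowDeg E x : ℝ) ≤ rowDeg E' x + 1 := by exact_mod_cast h.rowDeg_le_add_one hx
    linarith

/-- This supplies the matching that corrects the parity of an odd Δ. A cut matters only if S and the
complement of T have more than n vertices together; the smaller of the two then plays the left part,
after exchanging sides if necessary. -/
lemma exists_perfect (h : IsVertexDeletion E E' v Δ) (hE : IsPseudorandom E p L r)
    (hp : 0 < p) (hN : Fintype.card α * p = r ^ 2) (hL : 1000 ≤ L) (hr : 1000000 * L ^ 3 ≤ r)
    (hΔ : r ^ 2 + r / 8 ≤ Δ) : ∃ M ⊆ E', IsBiregular M 1 := by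
  have hL2 : 1000000 ≤ L ^ 2 := by nlinarith
  have hLr : 1000000000000 * L ≤ r := by nlinarith
  have hr0 : 0 < r := by linarith
  have hrL : 0 ≤ r * L := by nlinarith
  have hΔ' : r ^ 2 ≤ Δ := by linarith
  have hcard : ((E \ E').card : ℝ) ≤ 2 * r * L := by
    have := (h.le_and_card_le hE).2
    linarith
  have h1 : r ^ 2 - r * L - 1 ≥ r ^ 2 / 2 := by nlinarith
  have hrow : ∀ x, r ^ 2 / 2 ≤ rowDeg E' x := fun x =>
    h1.le.trans (h.le_rowDeg hE hΔ' hrL x)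
  have hcol : ∀ x, r ^ 2 / 2 ≤ rowDeg (swapEdges E') x := fun x =>
    h1.le.trans (h.swap.le_rowDeg hE.swap hΔ' hrL x)
  obtain ⟨M, hM, h2, h3⟩ := exists_subset_degrees_eq E' (fun _ => 1) (fun _ => 1) (by simp) (by
    intro S T
    simp only [Finset.sum_const, smul_eq_mul, mul_one]
    have hT := Finset.card_add_card_compl T
    have hS := Finset.card_le_univ S
    by_cases h4 : S.card + Tᶜ.card ≤ Fintype.card α
    · omega
    rcases le_total S.card Tᶜ.card with h5 | h5
    · have := card_le_edgeCount_of_card_add_card hE.1 hp hN hL hr h.subset hcard hrow h5 (by omega)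
      omega
    · have := card_le_edgeCount_of_card_add_card hE.2 hp hN hL hr h.swap.subset
        (by rwa [← swapEdges_sdiff, card_swapEdges]) hcol h5 (by omega)
      rw [edgeCount_swapEdges] at this
      omega)
  exact ⟨M, hM, h2, h3⟩

/-- Away from v no edge is deleted, so only edges of M are lost, at most one for each vertex of S.
-/
lemma edgeCount_le_add_card (h : IsVertexDeletion E E' v Δ) {M : Finset (α × α)} {ε : ℕ}
    (hMε : IsBiregular M ε) (hε : ε ≤ 1) {S T : Finset α} (hS : ∀ x ∈ S, Sum.inl x ≠ v)
    (hT : ∀ y ∈ T, Sum.inr y ≠ v) : edgeCount E S T ≤ edgeCount (E' \ M) S T + S.card := by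
  have h1 : (E.filter fun e => e.1 ∈ S ∧ e.2 ∈ T) ⊆
      ((E' \ M).filter fun e => e.1 ∈ S ∧ e.2 ∈ T) ∪ (M.filter fun e => e.1 ∈ S) := by
    intro e he
    simp only [Finset.mem_filter, Finset.mem_union, Finset.mem_sdiff] at he ⊢
    by_cases heM : e ∈ M
    · exact Or.inr ⟨heM, he.2.1⟩
    by_cases heE : e ∈ E'
    · exact Or.inl ⟨⟨heE, heM⟩, he.2⟩
    rcases h.eq_or_eq e (Finset.mem_sdiff.2 ⟨he.1, heE⟩) with h3 | h3
    · exact absurd h3 (hS _ he.2.1)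
    · exact absurd h3 (hT _ he.2.2)
  have h2 := (Finset.card_le_card h1).trans (Finset.card_union_le _ _)
  rw [← sum_rowDeg] at h2
  simp only [hMε.1, Finset.sum_const, smul_eq_mul] at h2
  have h3 : S.card * ε ≤ S.card * 1 := Nat.mul_le_mul_left _ hε
  unfold edgeCount
  omega

/-- The cut condition on the left for the subgraph of doubled edges. -/
lemma cut_le_of_small (h : IsVertexDeletion E E' v Δ) (hE : IsPseudorandom E p L r)
    (hp : 0 < p) (hL : 1000 ≤ L) (hr : 1000000 * L ^ 3 ≤ r) (hΔ : r ^ 2 + r / 8 ≤ Δ)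
    {M : Finset (α × α)} {ε : ℕ} (hMε : IsBiregular M ε) (hε : ε ≤ 1) (hM : M ⊆ E')
    {S : Finset α} (hS : ∀ x ∈ S, Sum.inl x ≠ v) (hsmall : 3072 * p * L ^ 2 * S.card ≤ r)
    (hf : ∀ x, ((Δ - rowDeg E' x : ℕ) : ℝ) ≤ 3 * r * L)
    (hg : ∀ x, ((Δ - colDeg E' x : ℕ) : ℝ) ≤ 3 * r * L) (T : Finset α) :
    ∑ x ∈ S, (Δ - rowDeg E' x) ≤ ∑ y ∈ T, (Δ - colDeg E' y) + edgeCount (E' \ M) S Tᶜ := by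
  have hGE : E' \ M ⊆ E := Finset.sdiff_subset.trans h.subset
  apply _root_.cut_le_of_small hE.1 hp hL hr hf hGE _ hsmall
  intro x hx
  apply le_card_neighbors_of_demand_pos hE.1 hL hr hΔ hg _ hGE _
  · intro y
    have := colDeg_mono h.subset y
    omega
  · have h1 := h.rowDeg_le_add_one (hS x hx)
    have h2 := rowDeg_sdiff hM x
    rw [hMε.1] at h2
    omega

lemma exists_doubling (h : IsVertexDeletion E E' v Δ) (hE : IsPseudorandom E p L r)
    (hp : 0 < p) (hN : Fintype.card α * p = r ^ 2) (hL : 1000 ≤ L) (hr : 1000000 * L ^ 3 ≤ r)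
    (hΔ : r ^ 2 + r / 8 ≤ Δ) {M : Finset (α × α)} {ε : ℕ} (hMε : IsBiregular M ε) (hε : ε ≤ 1)
    (hM : M ⊆ E') : ∃ F ⊆ E' \ M, (∀ x, rowDeg F x = Δ - rowDeg E' x) ∧
      ∀ y, colDeg F y = Δ - colDeg E' y := by
  have hL2 : 1000000 ≤ L ^ 2 := by nlinarith
  have hLr : 1000000000000 * L ≤ r := by nlinarith
  have hr0 : 0 < r := by linarith
  have hrL : 1 ≤ r * L := by nlinarith
  have hΔ' : r ^ 2 ≤ Δ := by linarith
  have hf : ∀ x, ((Δ - rowDeg E' x : ℕ) : ℝ) ≤ 3 * r * L := by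
    intro x
    rw [Nat.cast_sub (h.rowDeg_le x)]
    have := h.le_rowDeg hE hΔ' (by linarith) x
    have := (h.le_and_card_le hE).1
    linarith
  have hg : ∀ x, ((Δ - colDeg E' x : ℕ) : ℝ) ≤ 3 * r * L := by
    intro x
    rw [Nat.cast_sub (h.colDeg_le x)]
    have h1 := h.swap.le_rowDeg hE.swap hΔ' (by linarith) x
    rw [rowDeg_swapEdges] at h1
    have := (h.le_and_card_le hE).1
    linarith
  have hsumf : ∑ x, (Δ - rowDeg E' x) + E'.card = Fintype.card α * Δ := by
    rw [← sum_rowDeg_univ, ← Finset.sum_add_distrib,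
      Finset.sum_congr rfl fun x _ => Nat.sub_add_cancel (h.rowDeg_le x)]
    simp
  have hsumg : ∑ x, (Δ - colDeg E' x) + E'.card = Fintype.card α * Δ := by
    rw [← sum_colDeg_univ, ← Finset.sum_add_distrib,
      Finset.sum_congr rfl fun x _ => Nat.sub_add_cancel (h.colDeg_le x)]
    simp
  have hfg : ∑ x, (Δ - rowDeg E' x) = ∑ x, (Δ - colDeg E' x) := by omega
  have htotal : (Fintype.card α : ℝ) * (r / 16) ≤ ∑ x, ((Δ - rowDeg E' x : ℕ) : ℝ) := by
    have h1 : ∑ x, ((Δ - rowDeg E' x : ℕ) : ℝ) + E'.card = Fintype.card α * Δ := by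
      exact_mod_cast hsumf
    have h2 : (E'.card : ℝ) ≤ E.card := by exact_mod_cast Finset.card_le_card h.subset
    have h3 := hE.1.card_le
    have h4 : (Fintype.card α : ℝ) * (r ^ 2 + r / 8) ≤ Fintype.card α * Δ := by gcongr
    linarith
  have hcut : ∀ S T : Finset α, (∀ x ∈ S, Sum.inl x ≠ v) → (∀ y ∈ T, Sum.inr y ≠ v) →
      ∑ x ∈ S, (Δ - rowDeg E' x) ≤
        ∑ y ∈ Tᶜ, (Δ - colDeg E' y) + edgeCount (E' \ M) S T := by
    intro S T hS hT
    have hMε' : IsBiregular (swapEdges M) ε :=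
      ⟨fun x => by simpa using hMε.2 x, fun x => by simpa using hMε.1 x⟩
    have hT' : ∀ y ∈ T, Sum.inl y ≠ v.swap := by
      intro y hy h1
      exact hT y hy (by rw [← Sum.swap_swap v, ← h1]; rfl)
    have hS' : ∀ y ∈ S, Sum.inr y ≠ v.swap := by
      intro y hy h1
      exact hS y hy (by rw [← Sum.swap_swap v, ← h1]; rfl)
    by_cases hs : 3072 * p * L ^ 2 * S.card ≤ r
    · simpa using h.cut_le_of_small hE hp hL hr hΔ hMε hε hM hS hs hf hg Tᶜ
    have h1 := Finset.sum_add_sum_compl T fun y => Δ - colDeg E' y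
    have h2 := Finset.sum_add_sum_compl S fun y => Δ - rowDeg E' y
    by_cases ht : 3072 * p * L ^ 2 * T.card ≤ r
    · have h3 := h.swap.cut_le_of_small hE.swap hp hL hr hΔ hMε' hε
        (fun e he => by rw [mem_swapEdges] at he ⊢; exact hM he) hT' ht
        (by simpa using hg) (by simpa using hf) Sᶜ
      rw [← swapEdges_sdiff, edgeCount_swapEdges, compl_compl] at h3
      simp only [rowDeg_swapEdges, colDeg_swapEdges] at h3
      omega
    push Not at hs ht
    have h3 := h.swap.edgeCount_le_add_card hMε' hε hT' hS'
    rw [← swapEdges_sdiff, edgeCount_swapEdges, edgeCount_swapEdges] at h3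
    have h4 := cut_le_of_large hE.1 hp hN hL hr hf hg hfg htotal hs.le ht.le
      (h.edgeCount_le_add_card hMε hε hS hT) h3
    omega
  refine exists_subset_degrees_eq (E' \ M) _ _ hfg fun S T => ?_
  -- Since v has demand zero, removing it from the cut changes neither sum of demands and can only
  -- lower the edge count.
  have h1 := hcut (S.filter fun x => Sum.inl x ≠ v) (Tᶜ.filter fun y => Sum.inr y ≠ v)
    (fun x hx => (Finset.mem_filter.1 hx).2) (fun x hx => (Finset.mem_filter.1 hx).2)
  have h2 : ∑ x ∈ S.filter (fun x => Sum.inl x ≠ v), (Δ - rowDeg E' x) =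
      ∑ x ∈ S, (Δ - rowDeg E' x) := by
    apply Finset.sum_subset (Finset.filter_subset _ _)
    intro x hx hx'
    have hxv : Sum.inl x = v := by
      by_contra hne
      exact hx' (Finset.mem_filter.2 ⟨hx, hne⟩)
    rw [← h.degree_eq, ← hxv]
    simp
  have h3 : ∑ y ∈ (Tᶜ.filter fun y => Sum.inr y ≠ v)ᶜ, (Δ - colDeg E' y) =
      ∑ y ∈ T, (Δ - colDeg E' y) := by
    symm
    apply Finset.sum_subset
    · intro y hy
      simp [hy]
    · intro y hy hy'
      have hyv : Sum.inr y = v := by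
        by_contra hne
        simp [hne, hy'] at hy
      rw [← h.degree_eq, ← hyv]
      simp
  rw [h2, h3] at h1
  exact h1.trans (Nat.add_le_add_left
    (edgeCount_mono subset_rfl (Finset.filter_subset _ _) (Finset.filter_subset _ _)) _)

/-- Deleting edges at a vertex of largest degree from a pseudorandom bipartite graph leaves a graph
covered by two one-factorizations with `Δ` members in total. -/
theorem exists_cover [Nonempty α] (h : IsVertexDeletion E E' v Δ) (hE : IsPseudorandom E p L r)
    (hp : 0 < p) (hN : Fintype.card α * p = r ^ 2) (hL : 1000 ≤ L) (hr : 1000000 * L ^ 3 ≤ r)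
    (hΔ : r ^ 2 + r / 8 ≤ Δ) :
    ∃ (𝓜₁ 𝓜₂ : Finset (Finset (α × α))) (E₁ E₂ : Finset (α × α)), IsOneFactorization 𝓜₁ E₁ ∧
      IsOneFactorization 𝓜₂ E₂ ∧ E₁ ∪ E₂ = E' ∧ 𝓜₁.card + 𝓜₂.card = Δ := by
  obtain ⟨M, ε, hM, hMε, hε, heven⟩ : ∃ (M : Finset (α × α)) (ε : ℕ), M ⊆ E' ∧ IsBiregular M ε ∧
      ε ≤ 1 ∧ Even (Δ + ε) := by
    rcases Nat.even_or_odd Δ with hpar | hpar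
    · exact ⟨∅, 0, Finset.empty_subset _, ⟨fun x => by simp [rowDeg], fun y => by simp [colDeg]⟩,
        zero_le_one, hpar⟩
    · obtain ⟨M, hM, hM1⟩ := h.exists_perfect hE hp hN hL hr hΔ
      exact ⟨M, 1, hM, hM1, le_rfl, hpar.add_one⟩
  obtain ⟨F, hF, hFr, hFc⟩ := h.exists_doubling hE hp hN hL hr hΔ hMε hε hM
  exact exists_cover_of_doubling (hF.trans Finset.sdiff_subset) hM
    (Finset.disjoint_of_subset_left hF Finset.sdiff_disjoint) hMε heven
    (fun x => by rw [hFr]; exact Nat.sub_add_cancel (h.rowDeg_le x))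
    (fun y => by rw [hFc]; exact Nat.sub_add_cancel (h.colDeg_le y))

end IsVertexDeletion

end Deletion

/-! ### Translation between edge sets and simple graphs. -/

section BipartiteGraph

variable {n : ℕ}

/-- The edge of the bipartite graph that corresponds to a pair. -/
def pairEdge (e : Fin n × Fin n) : Sym2 (Fin n ⊕ Fin n) := s(Sum.inl e.1, Sum.inr e.2)

lemma pairEdge_injective : Function.Injective (pairEdge (n := n)) := by
  rintro ⟨a, b⟩ ⟨c, d⟩ h
  simp only [pairEdge, Sym2.eq_iff, Sum.inl.injEq, Sum.inr.injEq, reduceCtorEq, false_and,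
    or_false] at h
  exact Prod.ext h.1 h.2

@[simp] lemma bipartiteGraph_adj_inl_inr {E : Set (Fin n × Fin n)} {x y : Fin n} :
    (bipartiteGraph n E).Adj (Sum.inl x) (Sum.inr y) ↔ (x, y) ∈ E := by
  simp [bipartiteGraph]

@[simp] lemma bipartiteGraph_adj_inr_inl {E : Set (Fin n × Fin n)} {x y : Fin n} :
    (bipartiteGraph n E).Adj (Sum.inr y) (Sum.inl x) ↔ (x, y) ∈ E := by
  simp [bipartiteGraph]

@[simp] lemma bipartiteGraph_adj_inl_inl {E : Set (Fin n × Fin n)} {x y : Fin n} :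
    ¬ (bipartiteGraph n E).Adj (Sum.inl x) (Sum.inl y) := by
  simp [bipartiteGraph]

@[simp] lemma bipartiteGraph_adj_inr_inr {E : Set (Fin n × Fin n)} {x y : Fin n} :
    ¬ (bipartiteGraph n E).Adj (Sum.inr x) (Sum.inr y) := by
  simp [bipartiteGraph]

lemma edgeSet_bipartiteGraph (E : Set (Fin n × Fin n)) :
    (bipartiteGraph n E).edgeSet = pairEdge '' E := by
  ext e
  induction e with
  | _ u v =>
    simp only [SimpleGraph.mem_edgeSet, Set.mem_image, pairEdge, Sym2.eq_iff, bipartiteGraph,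
      Prod.exists]
    constructor
    · rintro (⟨x, y, h, rfl, rfl⟩ | ⟨x, y, h, rfl, rfl⟩)
      exacts [⟨x, y, h, Or.inl ⟨rfl, rfl⟩⟩, ⟨x, y, h, Or.inr ⟨rfl, rfl⟩⟩]
    · rintro ⟨x, y, h, (⟨rfl, rfl⟩ | ⟨rfl, rfl⟩)⟩
      exacts [Or.inl ⟨x, y, h, rfl, rfl⟩, Or.inr ⟨x, y, h, rfl, rfl⟩]

open scoped Classical in
lemma degree_bipartiteGraph (E : Finset (Fin n × Fin n)) (v : Fin n ⊕ Fin n) :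
    (bipartiteGraph n (E : Set (Fin n × Fin n))).degree v = v.elim (rowDeg E) (colDeg E) := by
  rw [← SimpleGraph.card_neighborFinset_eq_degree]
  rcases v with x | y
  · have : (bipartiteGraph n (E : Set (Fin n × Fin n))).neighborFinset (Sum.inl x) =
        (E.filter fun e => e.1 = x).image fun e => Sum.inr e.2 := by
      ext w
      rcases w with w | w <;> simp
    rw [this, Finset.card_image_of_injOn]
    · simp only [Sum.elim_inl, rowDeg]
    · intro a ha b hb hab
      simp only [Finset.coe_filter, Set.mem_ofPred_eq] at ha hb
      exact Prod.ext (ha.2.trans hb.2.symm) (Sum.inr_injective hab)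
  · have : (bipartiteGraph n (E : Set (Fin n × Fin n))).neighborFinset (Sum.inr y) =
        (E.filter fun e => e.2 = y).image fun e => Sum.inl e.1 := by
      ext w
      rcases w with w | w <;> simp
    rw [this, Finset.card_image_of_injOn]
    · simp only [Sum.elim_inr, colDeg]
    · intro a ha b hb hab
      simp only [Finset.coe_filter, Set.mem_ofPred_eq] at ha hb
      exact Prod.ext (Sum.inl_injective hab) (ha.2.trans hb.2.symm)

open scoped Classical in
lemma degree_le_secondMaxDegree {V : Type*} [Fintype V] (G : SimpleGraph V) {u v : V}
    (hv : G.degree v = G.maxDegree) (huv : u ≠ v) : G.degree u ≤ secondMaxDegree G := by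
  have h : min (G.degree u) (G.degree v) ≤ secondMaxDegree G :=
    Finset.le_sup (f := fun e : V × V => min (G.degree e.1) (G.degree e.2)) (b := (u, v))
      (by simpa using huv)
  rwa [hv, min_eq_left (G.degree_le_maxDegree u)] at h

open scoped Classical in
lemma secondMaxDegree_le_maxDegree {V : Type*} [Fintype V] (G : SimpleGraph V) :
    secondMaxDegree G ≤ G.maxDegree :=
  Finset.sup_le fun e _ => (min_le_left _ _).trans (G.degree_le_maxDegree e.1)

open scoped Classical in
/-- Deletions of edges at a vertex of largest degree in terms of edge sets. -/
lemma IsMaxDegreeDeletion.exists_isVertexDeletion {E : Finset (Fin n × Fin n)}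
    {G' : SimpleGraph (Fin n ⊕ Fin n)}
    (h : IsMaxDegreeDeletion (bipartiteGraph n (E : Set (Fin n × Fin n))) G') :
    ∃ (E' : Finset (Fin n × Fin n)) (v : Fin n ⊕ Fin n),
      G' = bipartiteGraph n (E' : Set (Fin n × Fin n)) ∧
      IsVertexDeletion E E' v
        (secondMaxDegree (bipartiteGraph n (E : Set (Fin n × Fin n)))) := by
  set G := bipartiteGraph n (E : Set (Fin n × Fin n)) with hG
  obtain ⟨v, hv, F, hF, hFcard, rfl⟩ := h
  let E' := E.filter fun e => pairEdge e ∉ F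
  have hsub : E' ⊆ E := Finset.filter_subset _ _
  have hmem : ∀ e ∈ E \ E', pairEdge e ∈ F := by
    intro e he
    simp only [E', Finset.mem_sdiff, Finset.mem_filter] at he
    tauto
  have heq : ∀ e ∈ E \ E', Sum.inl e.1 = v ∨ Sum.inr e.2 = v := by
    intro e he
    have h1 := hF (hmem e he)
    rw [SimpleGraph.mem_incidenceFinset] at h1
    have h2 : v ∈ pairEdge e := h1.2
    rw [pairEdge, Sym2.mem_iff] at h2
    rcases h2 with h2 | h2
    exacts [Or.inl h2.symm, Or.inr h2.symm]
  have himage : (E \ E').image pairEdge = F := by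
    apply Finset.Subset.antisymm
    · intro f hf
      obtain ⟨e, he, rfl⟩ := Finset.mem_image.1 hf
      exact hmem e he
    · intro f hf
      have h1 := hF hf
      rw [SimpleGraph.mem_incidenceFinset] at h1
      have h2 : f ∈ G.edgeSet := h1.1
      rw [hG, edgeSet_bipartiteGraph] at h2
      obtain ⟨e, he, rfl⟩ := h2
      refine Finset.mem_image_of_mem _ ?_
      simp only [E', Finset.mem_sdiff, Finset.mem_filter]
      exact ⟨he, fun h => h.2 hf⟩
  have hcard : (E \ E').card = G.maxDegree - secondMaxDegree G := by
    rw [← hFcard, ← himage, Finset.card_image_of_injective _ pairEdge_injective]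
  have hle := secondMaxDegree_le_maxDegree G
  -- All deleted edges are at v, so its degree falls by exactly the difference of the two largest
  -- degrees, and v still has the largest degree.
  have hdv : v.elim (rowDeg E') (colDeg E') = secondMaxDegree G := by
    rw [hG, degree_bipartiteGraph, ← hG] at hv
    rcases v with x | y
    · have h1 := rowDeg_sdiff hsub x
      have h2 : rowDeg (E \ E') x = (E \ E').card := by
        rw [rowDeg, Finset.filter_true_of_mem]
        intro e he
        simpa using heq e he
      simp only [Sum.elim_inl] at hv ⊢
      omega
    · have h1 := colDeg_sdiff hsub y
      have h2 : colDeg (E \ E') y = (E \ E').card := by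
        rw [colDeg, Finset.filter_true_of_mem]
        intro e he
        simpa using heq e he
      simp only [Sum.elim_inr] at hv ⊢
      omega
  refine ⟨E', v, ?_, hsub, heq, hdv, ?_, ?_⟩
  · apply SimpleGraph.edgeSet_injective
    rw [SimpleGraph.edgeSet_deleteEdges, edgeSet_bipartiteGraph, edgeSet_bipartiteGraph]
    ext f
    simp only [Set.mem_sdiff, Set.mem_image, Finset.mem_coe, E', Finset.mem_filter]
    constructor
    · rintro ⟨⟨e, he, rfl⟩, h⟩
      exact ⟨e, ⟨he, h⟩, rfl⟩
    · rintro ⟨e, ⟨he, h⟩, rfl⟩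
      exact ⟨⟨e, he, rfl⟩, h⟩
  · intro x
    by_cases hx : Sum.inl x = v
    · rw [← hdv, ← hx]; rfl
    · have := degree_le_secondMaxDegree G hv hx
      rw [hG, degree_bipartiteGraph, ← hG] at this
      exact (rowDeg_mono hsub x).trans this
  · intro x
    by_cases hx : Sum.inr x = v
    · rw [← hdv, ← hx]; rfl
    · have := degree_le_secondMaxDegree G hv hx
      rw [hG, degree_bipartiteGraph, ← hG] at this
      exact (colDeg_mono hsub x).trans this

/-- The spanning subgraph of `G` with edges in `M`. -/
def edgeSubgraph (G : SimpleGraph (Fin n ⊕ Fin n)) (M : Finset (Fin n × Fin n)) : G.Subgraph :=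
  SimpleGraph.toSubgraph (bipartiteGraph n (M : Set (Fin n × Fin n)) ⊓ G) inf_le_right

lemma edgeSet_edgeSubgraph {E M : Finset (Fin n × Fin n)} (hM : M ⊆ E) :
    (edgeSubgraph (bipartiteGraph n (E : Set (Fin n × Fin n))) M).edgeSet =
      pairEdge '' (M : Set (Fin n × Fin n)) := by
  have h : (edgeSubgraph (bipartiteGraph n (E : Set (Fin n × Fin n))) M).edgeSet =
      (bipartiteGraph n (M : Set (Fin n × Fin n)) ⊓
        bipartiteGraph n (E : Set (Fin n × Fin n))).edgeSet := by
    ext e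
    induction e with
    | _ u v => rfl
  rw [h, SimpleGraph.edgeSet_inf, edgeSet_bipartiteGraph, edgeSet_bipartiteGraph,
    Set.inter_eq_left]
  exact Set.image_mono (Finset.coe_subset.2 hM)

lemma isPerfectMatching_edgeSubgraph {E M : Finset (Fin n × Fin n)} (hM : M ⊆ E)
    (h1 : IsBiregular M 1) :
    (edgeSubgraph (bipartiteGraph n (E : Set (Fin n × Fin n))) M).IsPerfectMatching := by
  rw [SimpleGraph.Subgraph.isPerfectMatching_iff]
  have hadj : ∀ u v, (edgeSubgraph (bipartiteGraph n (E : Set (Fin n × Fin n))) M).Adj u v ↔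
      (bipartiteGraph n (M : Set (Fin n × Fin n))).Adj u v := by
    intro u v
    rw [← SimpleGraph.Subgraph.mem_edgeSet, ← SimpleGraph.mem_edgeSet, edgeSet_edgeSubgraph hM,
      edgeSet_bipartiteGraph]
  simp only [hadj]
  rintro (x | y)
  · obtain ⟨e, he⟩ := Finset.card_eq_one.1 (h1.1 x)
    have h2 : e ∈ M.filter fun e => e.1 = x := by simp [he]
    rw [Finset.mem_filter] at h2
    obtain ⟨heM, rfl⟩ := h2
    refine ⟨Sum.inr e.2, by simpa using heM, ?_⟩
    rintro (w | w) hw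
    · simp at hw
    · have h3 : (e.1, w) ∈ M.filter fun e' => e'.1 = e.1 := by simpa using hw
      rw [he, Finset.mem_singleton] at h3
      rw [← h3]
  · obtain ⟨e, he⟩ := Finset.card_eq_one.1 (h1.2 y)
    have h2 : e ∈ M.filter fun e => e.2 = y := by simp [he]
    rw [Finset.mem_filter] at h2
    obtain ⟨heM, rfl⟩ := h2
    refine ⟨Sum.inl e.1, by simpa using heM, ?_⟩
    rintro (w | w) hw
    · have h3 : (w, e.2) ∈ M.filter fun e' => e'.2 = e.2 := by simpa using hw
      rw [he, Finset.mem_singleton] at h3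
      rw [← h3]
    · simp at hw

open scoped Classical in
/-- Two one-factorizations that cover the edges of a bipartite graph give an optimal cover. -/
lemma hasOptimalMatchingCover_of_oneFactorization {E : Finset (Fin n × Fin n)}
    {𝓜₁ 𝓜₂ : Finset (Finset (Fin n × Fin n))} {E₁ E₂ : Finset (Fin n × Fin n)}
    (h₁ : IsOneFactorization 𝓜₁ E₁) (h₂ : IsOneFactorization 𝓜₂ E₂) (hE : E₁ ∪ E₂ = E)
    (hcard : 𝓜₁.card + 𝓜₂.card = (bipartiteGraph n (E : Set (Fin n × Fin n))).maxDegree) :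
    HasOptimalMatchingCover (bipartiteGraph n (E : Set (Fin n × Fin n))) := by
  set G := bipartiteGraph n (E : Set (Fin n × Fin n)) with hG
  have key : ∀ {𝓜 : Finset (Finset (Fin n × Fin n))} {F : Finset (Fin n × Fin n)},
      IsOneFactorization 𝓜 F → F ⊆ E → ∃ 𝓢 : Finset G.Subgraph,
        (∀ M ∈ 𝓢, M.IsPerfectMatching) ∧
        (∀ M ∈ 𝓢, ∀ M' ∈ 𝓢, M ≠ M' → Disjoint M.edgeSet M'.edgeSet) ∧
        (⋃ M ∈ 𝓢, M.edgeSet) = pairEdge '' (F : Set (Fin n × Fin n)) ∧ 𝓢.card = 𝓜.card := by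
    intro 𝓜 F hF hFE
    have hsub : ∀ M ∈ 𝓜, M ⊆ E := fun M hM =>
      (show M ⊆ F from hF.2.2 ▸ Finset.le_sup (f := id) hM).trans hFE
    refine ⟨𝓜.image (edgeSubgraph G), ?_, ?_, ?_, ?_⟩
    · simp only [Finset.mem_image, forall_exists_index, and_imp, forall_apply_eq_imp_iff₂]
      exact fun M hM => isPerfectMatching_edgeSubgraph (hsub M hM) (hF.1 M hM)
    · simp only [Finset.mem_image, forall_exists_index, and_imp, forall_apply_eq_imp_iff₂]
      intro M hM M' hM' hne
      rw [edgeSet_edgeSubgraph (hsub M hM), edgeSet_edgeSubgraph (hsub M' hM'),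
        Set.disjoint_image_iff pairEdge_injective, Finset.disjoint_coe]
      exact hF.2.1 M hM M' hM' fun h => hne (by rw [h])
    · ext f
      simp only [Set.mem_iUnion, Finset.mem_image, exists_prop, exists_exists_and_eq_and]
      rw [← hF.2.2]
      simp only [Set.mem_image, Finset.mem_coe, Finset.mem_sup, id]
      constructor
      · rintro ⟨M, hM, hf⟩
        rw [edgeSet_edgeSubgraph (hsub M hM)] at hf
        obtain ⟨e, he, rfl⟩ := hf
        exact ⟨e, ⟨M, hM, he⟩, rfl⟩
      · rintro ⟨e, ⟨M, hM, he⟩, rfl⟩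
        refine ⟨M, hM, ?_⟩
        rw [edgeSet_edgeSubgraph (hsub M hM)]
        exact ⟨e, he, rfl⟩
    · apply Finset.card_image_of_injOn
      intro M hM M' hM' h
      have h2 := congrArg SimpleGraph.Subgraph.edgeSet h
      rw [edgeSet_edgeSubgraph (hsub M hM), edgeSet_edgeSubgraph (hsub M' hM')] at h2
      exact Finset.coe_injective (pairEdge_injective.image_injective h2)
  obtain ⟨𝓢₁, a1, b1, c1, d1⟩ := key h₁ (hE ▸ Finset.subset_union_left)
  obtain ⟨𝓢₂, a2, b2, c2, d2⟩ := key h₂ (hE ▸ Finset.subset_union_right)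
  refine ⟨𝓢₁, 𝓢₂, a1, a2, b1, b2, ?_, by rw [d1, d2, hcard]⟩
  rw [c1, c2, ← Set.image_union, ← Finset.coe_union, hE, hG, edgeSet_bipartiteGraph]

open scoped Classical in
lemma IsVertexDeletion.maxDegree_eq {E E' : Finset (Fin n × Fin n)} {v : Fin n ⊕ Fin n} {Δ : ℕ}
    (h : IsVertexDeletion E E' v Δ) :
    (bipartiteGraph n (E' : Set (Fin n × Fin n))).maxDegree = Δ := by
  apply le_antisymm
  · apply SimpleGraph.maxDegree_le_of_forall_degree_le
    rintro (x | y) <;> rw [degree_bipartiteGraph]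
    exacts [h.rowDeg_le x, h.colDeg_le y]
  · rw [← h.degree_eq, ← degree_bipartiteGraph]
    exact SimpleGraph.degree_le_maxDegree _ _

open scoped Classical in
-- There is a vertex of large degree on each side, and vertices on different sides are distinct.
lemma IsPseudorandom.le_secondMaxDegree {E : Finset (Fin n × Fin n)} {p L r : ℝ}
    (h : IsPseudorandom E p L r) :
    r ^ 2 + r / 8 ≤ secondMaxDegree (bipartiteGraph n (E : Set (Fin n × Fin n))) := by
  set G := bipartiteGraph n (E : Set (Fin n × Fin n)) with hG
  obtain ⟨x, hx⟩ := h.1.exists_le_rowDeg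
  obtain ⟨y, hy⟩ := h.2.exists_le_rowDeg
  have h1 : min (G.degree (Sum.inl x)) (G.degree (Sum.inr y)) ≤ secondMaxDegree G :=
    Finset.le_sup (f := fun e : (Fin n ⊕ Fin n) × (Fin n ⊕ Fin n) =>
      min (G.degree e.1) (G.degree e.2)) (b := (Sum.inl x, Sum.inr y)) (by simp)
  rw [hG, degree_bipartiteGraph, degree_bipartiteGraph, ← hG] at h1
  have h2 : (min (rowDeg E x : ℝ) (colDeg E y)) ≤ secondMaxDegree G := by exact_mod_cast h1
  exact (le_min hx (by simpa using hy)).trans h2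

/-- All deletions from a pseudorandom bipartite graph have an optimal cover. -/
theorem IsPseudorandom.hasOptimalMatchingCover [NeZero n] {E : Finset (Fin n × Fin n)} {p L r : ℝ}
    (hE : IsPseudorandom E p L r) (hp : 0 < p) (hN : n * p = r ^ 2) (hL : 1000 ≤ L)
    (hr : 1000000 * L ^ 3 ≤ r) {G' : SimpleGraph (Fin n ⊕ Fin n)}
    (h : IsMaxDegreeDeletion (bipartiteGraph n (E : Set (Fin n × Fin n))) G') :
    HasOptimalMatchingCover G' := by
  classical
  obtain ⟨E', v, rfl, hdel⟩ := h.exists_isVertexDeletion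
  obtain ⟨𝓜₁, 𝓜₂, E₁, E₂, h₁, h₂, hu, hcard⟩ :=
    hdel.exists_cover hE hp (by simpa using hN) hL hr hE.le_secondMaxDegree
  refine hasOptimalMatchingCover_of_oneFactorization h₁ h₂ hu ?_
  rw [hcard]
  convert hdel.maxDegree_eq.symm

end BipartiteGraph

/-! ### Random subsets with independent elements: moments and tail bounds. -/

section BernoulliSubset

variable {ι : Type*} [Fintype ι] [DecidableEq ι]

/-- The probability that the random subset containing each element independently with probability
`p` is equal to `E`. -/
def bernoulliWeight (p : ℝ) (E : Finset ι) : ℝ := ∏ i, if i ∈ E then p else 1 - p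

open scoped Classical in
/-- The probability of `Q` under `bernoulliWeight p`. -/
noncomputable def bernoulliProb (p : ℝ) (Q : Finset ι → Prop) : ℝ :=
  ∑ E, bernoulliWeight p E * if Q E then 1 else 0

lemma bernoulliWeight_nonneg {p : ℝ} (h0 : 0 ≤ p) (h1 : p ≤ 1) (E : Finset ι) :
    0 ≤ bernoulliWeight p E :=
  Finset.prod_nonneg fun i _ => by split_ifs <;> linarith

lemma sum_prod_mem_ite (a b : ι → ℝ) :
    ∑ E : Finset ι, ∏ i, (if i ∈ E then a i else b i) = ∏ i, (a i + b i) := by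
  rw [Finset.prod_add, Finset.powerset_univ]
  refine Finset.sum_congr rfl fun E _ => ?_
  rw [Finset.prod_ite]
  congr 1
  · exact Finset.prod_congr (by ext; simp) fun _ _ => rfl
  · exact Finset.prod_congr (by ext; simp) fun _ _ => rfl

/-- Expectations of products of functions of the single elements factor. -/
lemma sum_bernoulliWeight_mul_prod (p : ℝ) (a b : ι → ℝ) :
    ∑ E : Finset ι, bernoulliWeight p E * ∏ i, (if i ∈ E then a i else b i) =
      ∏ i, (p * a i + (1 - p) * b i) := by
  rw [← sum_prod_mem_ite]
  refine Finset.sum_congr rfl fun E _ => ?_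
  rw [bernoulliWeight, ← Finset.prod_mul_distrib]
  refine Finset.prod_congr rfl fun i _ => ?_
  split_ifs <;> rfl

lemma sum_bernoulliWeight (p : ℝ) : ∑ E : Finset ι, bernoulliWeight p E = 1 := by
  have := sum_bernoulliWeight_mul_prod (ι := ι) p (fun _ => 1) (fun _ => 1)
  simpa using this

/-- Markov's inequality, in the form from which the Chernoff and Chebyshev bounds are derived. -/
lemma bernoulliProb_le_sum {p : ℝ} (h0 : 0 ≤ p) (h1 : p ≤ 1) {Q : Finset ι → Prop}
    {f : Finset ι → ℝ} (hf : ∀ E, 0 ≤ f E) (hQ : ∀ E, Q E → 1 ≤ f E) :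
    bernoulliProb p Q ≤ ∑ E, bernoulliWeight p E * f E := by
  refine Finset.sum_le_sum fun E _ => ?_
  refine mul_le_mul_of_nonneg_left ?_ (bernoulliWeight_nonneg h0 h1 E)
  split_ifs with h
  exacts [hQ E h, hf E]

lemma bernoulliProb_mono {p : ℝ} (h0 : 0 ≤ p) (h1 : p ≤ 1) {Q R : Finset ι → Prop}
    (h : ∀ E, Q E → R E) : bernoulliProb p Q ≤ bernoulliProb p R := by
  refine Finset.sum_le_sum fun E _ => ?_
  refine mul_le_mul_of_nonneg_left ?_ (bernoulliWeight_nonneg h0 h1 E)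
  by_cases hQ : Q E
  · simp [hQ, h E hQ]
  · rw [if_neg hQ]
    split_ifs <;> norm_num

lemma bernoulliProb_nonneg {p : ℝ} (h0 : 0 ≤ p) (h1 : p ≤ 1) (Q : Finset ι → Prop) :
    0 ≤ bernoulliProb p Q :=
  Finset.sum_nonneg fun E _ => mul_nonneg (bernoulliWeight_nonneg h0 h1 E) (by split_ifs <;> norm_num)

lemma bernoulliProb_or_le {p : ℝ} (h0 : 0 ≤ p) (h1 : p ≤ 1) {Q R : Finset ι → Prop} {a b : ℝ}
    (hQ : bernoulliProb p Q ≤ a) (hR : bernoulliProb p R ≤ b) :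
    bernoulliProb p (fun E => Q E ∨ R E) ≤ a + b := by
  refine le_trans ?_ (add_le_add hQ hR)
  unfold bernoulliProb
  rw [← Finset.sum_add_distrib]
  refine Finset.sum_le_sum fun E _ => ?_
  rw [← mul_add]
  refine mul_le_mul_of_nonneg_left ?_ (bernoulliWeight_nonneg h0 h1 E)
  by_cases hQ : Q E <;> by_cases hR : R E <;> simp [hQ, hR]

lemma bernoulliProb_exists_le {p : ℝ} (h0 : 0 ≤ p) (h1 : p ≤ 1) {κ : Type*} (s : Finset κ)
    (Q : κ → Finset ι → Prop) :
    bernoulliProb p (fun E => ∃ k ∈ s, Q k E) ≤ ∑ k ∈ s, bernoulliProb p (Q k) := by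
  classical
  unfold bernoulliProb
  rw [Finset.sum_comm]
  refine Finset.sum_le_sum fun E _ => ?_
  rw [← Finset.mul_sum]
  refine mul_le_mul_of_nonneg_left ?_ (bernoulliWeight_nonneg h0 h1 E)
  split_ifs with h
  · obtain ⟨k, hk, hkE⟩ := h
    calc (1 : ℝ) = if Q k E then 1 else 0 := by simp [hkE]
      _ ≤ _ := Finset.single_le_sum (f := fun k => if Q k E then (1 : ℝ) else 0)
        (fun _ _ => by split_ifs <;> norm_num) hk
  · exact Finset.sum_nonneg fun _ _ => by split_ifs <;> norm_num

lemma exp_mul_card_inter (c : ℝ) (A E : Finset ι) :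
    Real.exp (c * (E ∩ A).card) =
      ∏ i, (if i ∈ E then (if i ∈ A then Real.exp c else 1) else 1) := by
  rw [mul_comm, Real.exp_nat_mul]
  calc Real.exp c ^ (E ∩ A).card = ∏ i ∈ E ∩ A, Real.exp c := by simp
    _ = ∏ i, if i ∈ E ∩ A then Real.exp c else 1 := by
      rw [Finset.prod_ite_mem, Finset.univ_inter]
    _ = _ := by
      refine Finset.prod_congr rfl fun i _ => ?_
      by_cases h1 : i ∈ E <;> by_cases h2 : i ∈ A <;> simp [h1, h2]

/-- The moment generating function of the number of chosen elements of `A`. -/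
lemma sum_bernoulliWeight_mul_exp (p c : ℝ) (A : Finset ι) :
    ∑ E, bernoulliWeight p E * Real.exp (c * (E ∩ A).card) =
      (1 + p * (Real.exp c - 1)) ^ A.card := by
  simp only [exp_mul_card_inter]
  rw [sum_bernoulliWeight_mul_prod]
  calc ∏ i, (p * (if i ∈ A then Real.exp c else 1) + (1 - p) * 1)
      = ∏ i, (if i ∈ A then 1 + p * (Real.exp c - 1) else 1) := by
        refine Finset.prod_congr rfl fun i _ => ?_
        split_ifs <;> ring
    _ = ∏ i ∈ A, (1 + p * (Real.exp c - 1)) := by simp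
    _ = _ := by simp

/-- This combines exp c ≤ 1 + c + c² for |c| ≤ 1 with 1 + x ≤ exp x. Negative c are allowed, which
gives lower tails. -/
lemma one_add_mul_exp_sub_one_pow_le {p c : ℝ} (h0 : 0 ≤ p) (h1 : p ≤ 1) (hc : |c| ≤ 1) (k : ℕ) :
    (1 + p * (Real.exp c - 1)) ^ k ≤ Real.exp (p * k * (c + c ^ 2)) := by
  have h2 := (abs_le.1 (Real.abs_exp_sub_one_sub_id_le hc)).2
  have h3 : 0 ≤ 1 + p * (Real.exp c - 1) := by nlinarith [Real.exp_pos c]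
  calc (1 + p * (Real.exp c - 1)) ^ k ≤ (Real.exp (p * (c + c ^ 2))) ^ k := by
        gcongr
        have h4 : p * (Real.exp c - 1) ≤ p * (c + c ^ 2) := by gcongr; linarith
        linarith [Real.add_one_le_exp (p * (c + c ^ 2))]
    _ = _ := by rw [← Real.exp_nat_mul]; ring_nf

/-- Chernoff's inequality, for both tails. -/
lemma bernoulliProb_chernoff {p c : ℝ} (h0 : 0 ≤ p) (h1 : p ≤ 1) (hc : |c| ≤ 1) (A : Finset ι)
    (a : ℝ) : bernoulliProb p (fun E => c * a ≤ c * (E ∩ A).card) ≤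
      Real.exp (p * A.card * (c + c ^ 2) - c * a) := by
  calc bernoulliProb p (fun E => c * a ≤ c * (E ∩ A).card)
      ≤ ∑ E, bernoulliWeight p E * (Real.exp (-(c * a)) * Real.exp (c * (E ∩ A).card)) := by
        apply bernoulliProb_le_sum h0 h1
        · intro E; positivity
        · intro E hE
          rw [← Real.exp_add]
          apply Real.one_le_exp
          linarith
    _ = Real.exp (-(c * a)) * (1 + p * (Real.exp c - 1)) ^ A.card := by
        rw [← sum_bernoulliWeight_mul_exp, Finset.mul_sum]
        refine Finset.sum_congr rfl fun E _ => ?_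
        ring
    _ ≤ Real.exp (-(c * a)) * Real.exp (p * A.card * (c + c ^ 2)) := by
        gcongr
        exact one_add_mul_exp_sub_one_pow_le h0 h1 hc _
    _ = _ := by rw [← Real.exp_add]; ring_nf

/-- Written as a product over single elements, the indicator of a prescribed trace on R can be
factored in expectations. -/
lemma ite_inter_eq {R W : Finset ι} (hW : W ⊆ R) (E : Finset ι) [Decidable (E ∩ R = W)] :
    (if E ∩ R = W then (1 : ℝ) else 0) =
      ∏ i, (if i ∈ E then (if i ∈ R \ W then 0 else 1) else (if i ∈ W then 0 else 1)) := by
  split_ifs with h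
  · symm
    apply Finset.prod_eq_one
    intro i _
    subst h
    by_cases hi : i ∈ E <;> simp [hi]
  · obtain ⟨i, hi⟩ : ∃ i, ¬ (i ∈ E ∩ R ↔ i ∈ W) := by
      by_contra! hcon
      exact h (Finset.ext hcon)
    symm
    apply Finset.prod_eq_zero (Finset.mem_univ i)
    have := @hW i
    by_cases h1 : i ∈ E <;> by_cases h2 : i ∈ W <;> by_cases h3 : i ∈ R <;>
      simp_all

/-- Chernoff's inequality conditional on the chosen elements of a set disjoint from `A`. -/
lemma bernoulliProb_inter_eq_and_le {p c : ℝ} (h0 : 0 ≤ p) (h1 : p ≤ 1) (hc : |c| ≤ 1)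
    {R W A : Finset ι} (hW : W ⊆ R) (hRA : Disjoint R A) (a : ℝ) :
    bernoulliProb p (fun E => E ∩ R = W ∧ c * a ≤ c * (E ∩ A).card) ≤
      bernoulliProb p (fun E => E ∩ R = W) * Real.exp (p * A.card * (c + c ^ 2) - c * a) := by
  classical
  have hprod : ∑ E, bernoulliWeight p E *
      ((if E ∩ R = W then (1 : ℝ) else 0) * Real.exp (c * (E ∩ A).card)) =
      bernoulliProb p (fun E => E ∩ R = W) * (1 + p * (Real.exp c - 1)) ^ A.card := by
    unfold bernoulliProb
    rw [← sum_bernoulliWeight_mul_exp]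
    have e1 : ∀ E : Finset ι,
        (if E ∩ R = W then (1 : ℝ) else 0) * Real.exp (c * (E ∩ A).card) =
        ∏ i, (if i ∈ E then (if i ∈ R \ W then 0 else 1) * (if i ∈ A then Real.exp c else 1)
          else (if i ∈ W then 0 else 1)) := by
      intro E
      rw [ite_inter_eq hW, exp_mul_card_inter, ← Finset.prod_mul_distrib]
      refine Finset.prod_congr rfl fun i _ => ?_
      by_cases hi : i ∈ E <;> simp [hi]
    simp only [e1]
    simp only [ite_inter_eq hW, exp_mul_card_inter]
    rw [sum_bernoulliWeight_mul_prod, sum_bernoulliWeight_mul_prod, sum_bernoulliWeight_mul_prod,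
      ← Finset.prod_mul_distrib]
    refine Finset.prod_congr rfl fun i _ => ?_
    by_cases hA : i ∈ A
    · have hR : i ∉ R := fun h => Finset.disjoint_left.1 hRA h hA
      have hW' : i ∉ W := fun h => hR (hW h)
      simp [hA, hR, hW']
    · simp only [hA, if_false]
      ring
  calc bernoulliProb p (fun E => E ∩ R = W ∧ c * a ≤ c * (E ∩ A).card)
      ≤ ∑ E, bernoulliWeight p E * (Real.exp (-(c * a)) *
          ((if E ∩ R = W then (1 : ℝ) else 0) * Real.exp (c * (E ∩ A).card))) := by
        apply bernoulliProb_le_sum h0 h1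
        · intro E
          have : (0 : ℝ) ≤ if E ∩ R = W then (1 : ℝ) else 0 := by split_ifs <;> norm_num
          positivity
        · rintro E ⟨hE, hE'⟩
          rw [if_pos hE, one_mul, ← Real.exp_add]
          apply Real.one_le_exp
          linarith
    _ = Real.exp (-(c * a)) *
        (bernoulliProb p (fun E => E ∩ R = W) * (1 + p * (Real.exp c - 1)) ^ A.card) := by
        rw [← hprod, Finset.mul_sum]
        refine Finset.sum_congr rfl fun E _ => ?_
        ring
    _ ≤ Real.exp (-(c * a)) *
        (bernoulliProb p (fun E => E ∩ R = W) * Real.exp (p * A.card * (c + c ^ 2))) := by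
        have := bernoulliProb_nonneg h0 h1 fun E : Finset ι => E ∩ R = W
        gcongr
        exact one_add_mul_exp_sub_one_pow_le h0 h1 hc _
    _ = bernoulliProb p (fun E => E ∩ R = W) *
        (Real.exp (-(c * a)) * Real.exp (p * A.card * (c + c ^ 2))) := by ring
    _ = _ := by rw [← Real.exp_add]; ring_nf

lemma sum_bernoulliProb_inter_eq_le {p : ℝ} (h0 : 0 ≤ p) (h1 : p ≤ 1) (R : Finset ι)
    (s : Finset (Finset ι)) : ∑ W ∈ s, bernoulliProb p (fun E => E ∩ R = W) ≤ 1 := by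
  classical
  unfold bernoulliProb
  rw [Finset.sum_comm]
  refine le_trans (Finset.sum_le_sum fun E _ => ?_) (sum_bernoulliWeight (ι := ι) p).le
  rw [← Finset.mul_sum]
  refine mul_le_of_le_one_right (bernoulliWeight_nonneg h0 h1 E) ?_
  have h : ((s.filter fun W => E ∩ R = W).card : ℝ) ≤ 1 := by
    exact_mod_cast Finset.card_le_one.2 fun V hV W hW => by
      rw [Finset.mem_filter] at hV hW
      exact hV.2.symm.trans hW.2
  rw [Finset.card_filter] at h
  push_cast at h
  refine (Finset.sum_congr rfl fun W _ => ?_).trans_le h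
  congr

/-- If the sets `A k` are disjoint of the same size, the exponential sum of their numbers of chosen
elements is rarely less than half its mean. -/
lemma bernoulliProb_sum_exp_le {p : ℝ} (h0 : 0 ≤ p) (h1 : p ≤ 1) {κ : Type*} [Fintype κ]
    [DecidableEq κ] [Nonempty κ] {A : κ → Finset ι} {m : ℕ} (hA : ∀ k, (A k).card = m)
    (hdisj : ∀ k l, k ≠ l → Disjoint (A k) (A l)) (c : ℝ) :
    bernoulliProb p (fun E => ∑ k, Real.exp (c * (E ∩ A k).card) ≤
        Fintype.card κ * (1 + p * (Real.exp c - 1)) ^ m / 2) ≤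
      4 * (1 + p * (Real.exp (2 * c) - 1)) ^ m /
        (Fintype.card κ * ((1 + p * (Real.exp c - 1)) ^ m) ^ 2) := by
  set N : ℝ := (Fintype.card κ : ℝ) with hN
  have hN0 : 0 < N := by rw [hN]; exact_mod_cast Fintype.card_pos
  have hb : 0 < 1 + p * (Real.exp c - 1) := by
    rcases eq_or_lt_of_le h0 with rfl | hp
    · simp
    · nlinarith [Real.exp_pos c, mul_pos hp (Real.exp_pos c)]
  set μ : ℝ := (1 + p * (Real.exp c - 1)) ^ m with hμ
  have hμ0 : 0 < μ := pow_pos hb m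
  set ν : ℝ := (1 + p * (Real.exp (2 * c) - 1)) ^ m with hν
  -- By disjointness the off-diagonal terms are exactly μ² and cancel in the variance, leaving at
  -- most Nν.
  have hcross : ∀ k l, ∑ E, bernoulliWeight p E *
      (Real.exp (c * (E ∩ A k).card) * Real.exp (c * (E ∩ A l).card)) ≤
        μ ^ 2 + if k = l then ν else 0 := by
    intro k l
    split_ifs with hkl
    · subst hkl
      have : ∀ E : Finset ι, Real.exp (c * (E ∩ A k).card) * Real.exp (c * (E ∩ A k).card) =
          Real.exp (2 * c * (E ∩ A k).card) := by
        intro E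
        rw [← Real.exp_add]
        ring_nf
      simp only [this]
      rw [sum_bernoulliWeight_mul_exp, hA]
      nlinarith [sq_nonneg μ]
    · have : ∀ E : Finset ι, Real.exp (c * (E ∩ A k).card) * Real.exp (c * (E ∩ A l).card) =
          Real.exp (c * (E ∩ (A k ∪ A l)).card) := by
        intro E
        rw [← Real.exp_add, Finset.inter_union_distrib_left, Finset.card_union_of_disjoint]
        · push_cast; ring_nf
        · exact Finset.disjoint_of_subset_left Finset.inter_subset_right
            (Finset.disjoint_of_subset_right Finset.inter_subset_right (hdisj k l hkl))
      simp only [this]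
      rw [sum_bernoulliWeight_mul_exp, Finset.card_union_of_disjoint (hdisj k l hkl), hA, hA,
        pow_add]
      exact le_of_eq (by ring)
  have hmean : ∑ E, bernoulliWeight p E * ∑ k, Real.exp (c * (E ∩ A k).card) = N * μ := by
    simp only [Finset.mul_sum]
    rw [Finset.sum_comm]
    simp only [sum_bernoulliWeight_mul_exp, hA]
    simp [hN, hμ]
  have hvar : ∑ E, bernoulliWeight p E *
      (∑ k, Real.exp (c * (E ∩ A k).card) - N * μ) ^ 2 ≤ N * ν := by
    have e1 : ∑ E, bernoulliWeight p E * (∑ k, Real.exp (c * (E ∩ A k).card)) ^ 2 ≤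
        (N * μ) ^ 2 + N * ν := by
      calc ∑ E, bernoulliWeight p E * (∑ k, Real.exp (c * (E ∩ A k).card)) ^ 2
          = ∑ k, ∑ l, ∑ E, bernoulliWeight p E *
            (Real.exp (c * (E ∩ A k).card) * Real.exp (c * (E ∩ A l).card)) := by
            have e3 : ∀ E : Finset ι, (∑ k, Real.exp (c * (E ∩ A k).card)) ^ 2 =
                ∑ k, ∑ l, Real.exp (c * (E ∩ A k).card) * Real.exp (c * (E ∩ A l).card) :=
              fun E => by rw [sq, Finset.sum_mul_sum]
            simp only [e3, Finset.mul_sum]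
            rw [Finset.sum_comm]
            refine Finset.sum_congr rfl fun k _ => ?_
            rw [Finset.sum_comm]
        _ ≤ ∑ k, ∑ l, (μ ^ 2 + if k = l then ν else 0) :=
            Finset.sum_le_sum fun k _ => Finset.sum_le_sum fun l _ => hcross k l
        _ = _ := by
            simp only [Finset.sum_add_distrib, Finset.sum_ite_eq, Finset.mem_univ, if_true,
              Finset.sum_const, Finset.card_univ, nsmul_eq_mul, ← hN]
            ring
    have e2 : ∀ E : Finset ι, bernoulliWeight p E *
        (∑ k, Real.exp (c * (E ∩ A k).card) - N * μ) ^ 2 =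
        bernoulliWeight p E * (∑ k, Real.exp (c * (E ∩ A k).card)) ^ 2 -
        (2 * (N * μ)) * (bernoulliWeight p E * ∑ k, Real.exp (c * (E ∩ A k).card)) +
        (N * μ) ^ 2 * bernoulliWeight p E := fun E => by ring
    simp only [e2]
    rw [Finset.sum_add_distrib, Finset.sum_sub_distrib, ← Finset.mul_sum, ← Finset.mul_sum, hmean,
      sum_bernoulliWeight]
    nlinarith
  -- Chebyshev's inequality: on the event, the sum falls short of its mean Nμ by at least Nμ/2.
  calc _ ≤ ∑ E, bernoulliWeight p E *
        ((∑ k, Real.exp (c * (E ∩ A k).card) - N * μ) ^ 2 / (N * μ / 2) ^ 2) := by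
        apply bernoulliProb_le_sum h0 h1
        · intro E; positivity
        · intro E hE
          rw [le_div_iff₀ (by positivity), one_mul]
          have h3 : N * μ / 2 ≤ N * μ - ∑ k, Real.exp (c * (E ∩ A k).card) := by linarith
          calc (N * μ / 2) ^ 2 ≤ (N * μ - ∑ k, Real.exp (c * (E ∩ A k).card)) ^ 2 := by
                gcongr
            _ = _ := by ring
    _ = (∑ E, bernoulliWeight p E * (∑ k, Real.exp (c * (E ∩ A k).card) - N * μ) ^ 2) /
        (N * μ / 2) ^ 2 := by
        rw [Finset.sum_div]
        refine Finset.sum_congr rfl fun E _ => ?_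
        ring
    _ ≤ N * ν / (N * μ / 2) ^ 2 := by gcongr
    _ = _ := by field_simp; norm_num

end BernoulliSubset

/-! ### Pseudorandomness of the random bipartite graph. -/

section RandomBipartite

variable {α : Type*} [DecidableEq α] [Fintype α]

lemma edgeCount_eq_card_inter (E : Finset (α × α)) (S T : Finset α) :
    edgeCount E S T = (E ∩ S ×ˢ T).card := by
  rw [edgeCount]
  congr 1
  ext e
  simp

lemma rowDeg_eq_card_inter (E : Finset (α × α)) (x : α) :
    rowDeg E x = (E ∩ {x} ×ˢ Finset.univ).card := by
  rw [rowDeg]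
  congr 1
  ext e
  simp only [Finset.mem_filter, Finset.mem_inter, Finset.mem_product, Finset.mem_singleton,
    Finset.mem_univ, and_true]

/-- The distribution is symmetric in the two sides, so estimates for the left carry over to the
right. -/
lemma bernoulliProb_swapEdges (p : ℝ) (Q : Finset (α × α) → Prop) :
    bernoulliProb p (fun E => Q (swapEdges E)) = bernoulliProb p Q := by
  classical
  let φ : Finset (α × α) ≃ Finset (α × α) :=
    ⟨swapEdges, swapEdges, swapEdges_swapEdges, swapEdges_swapEdges⟩
  refine Fintype.sum_equiv φ _ _ fun E => ?_
  have : bernoulliWeight p (swapEdges E) = bernoulliWeight p E := by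
    refine Fintype.prod_equiv (Equiv.prodComm α α) _ _ fun i => ?_
    by_cases h : i.swap ∈ E <;> simp [h]
  change _ = bernoulliWeight p (swapEdges E) * _
  rw [this]
  rfl

variable {p L r : ℝ}

lemma bernoulliProb_rowDeg_le (h0 : 0 < p) (h1 : p ≤ 1) (hN : Fintype.card α * p = r ^ 2)
    (hL : 1000 ≤ L) (hr : 1000000 * L ^ 3 ≤ r) (hn : (Fintype.card α : ℝ) = Real.exp L) :
    bernoulliProb p (fun E : Finset (α × α) => ∃ x ∈ Finset.univ,
      ¬ |(rowDeg E x : ℝ) - r ^ 2| ≤ r * L) ≤ 2 * Real.exp (-L) := by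
  have hL2 : 1000000 ≤ L ^ 2 := by nlinarith
  have hLr : 1000000000000 * L ≤ r := by nlinarith
  have hr0 : 0 < r := by linarith
  refine (bernoulliProb_exists_le h0.le h1 _ _).trans ?_
  have key : ∀ x ∈ (Finset.univ : Finset α), bernoulliProb p (fun E : Finset (α × α) =>
      ¬ |(rowDeg E x : ℝ) - r ^ 2| ≤ r * L) ≤ 2 * Real.exp (-(2 * L)) := by
    intro x _
    -- This minimizes the exponent (cr)² - crL, with value -L²/4.
    set c : ℝ := L / (2 * r) with hc
    have hc0 : 0 < c := by positivity
    have hc1 : c ≤ 1 := by rw [hc, div_le_one (by positivity)]; linarith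
    have hcr : c * r = L / 2 := by rw [hc]; field_simp
    have hcard : p * (({x} : Finset α) ×ˢ (Finset.univ : Finset α)).card = r ^ 2 := by
      rw [← hN]; simp [mul_comm]
    have u1 := bernoulliProb_chernoff h0.le h1 (c := c) (by rw [abs_of_pos hc0]; exact hc1)
      (({x} : Finset α) ×ˢ (Finset.univ : Finset α)) (r ^ 2 + r * L)
    have u2 := bernoulliProb_chernoff h0.le h1 (c := -c) (by rw [abs_neg, abs_of_pos hc0]; exact hc1)
      (({x} : Finset α) ×ˢ (Finset.univ : Finset α)) (r ^ 2 - r * L)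
    rw [hcard] at u1 u2
    have e1 : r ^ 2 * (c + c ^ 2) - c * (r ^ 2 + r * L) ≤ -(2 * L) := by
      have : r ^ 2 * (c + c ^ 2) - c * (r ^ 2 + r * L) = (c * r) ^ 2 - (c * r) * L := by ring
      rw [this, hcr]; nlinarith
    have e2 : r ^ 2 * (-c + (-c) ^ 2) - -c * (r ^ 2 - r * L) ≤ -(2 * L) := by
      have : r ^ 2 * (-c + (-c) ^ 2) - -c * (r ^ 2 - r * L) = (c * r) ^ 2 - (c * r) * L := by ring
      rw [this, hcr]; nlinarith
    have v1 := u1.trans (Real.exp_le_exp.2 e1)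
    have v2 := u2.trans (Real.exp_le_exp.2 e2)
    refine (bernoulliProb_mono h0.le h1 (R := fun E => _ ∨ _) fun E hE => ?_).trans
      ((bernoulliProb_or_le h0.le h1 v1 v2).trans_eq (by ring))
    rw [← rowDeg_eq_card_inter]
    by_contra! hcon
    refine hE (abs_le.2 ⟨?_, ?_⟩)
    · nlinarith
    · nlinarith
  refine (Finset.sum_le_sum key).trans_eq ?_
  rw [Finset.sum_const, Finset.card_univ, nsmul_eq_mul, hn, mul_left_comm, ← Real.exp_add]
  ring_nf

/-- The union bound over pairs of sets of which the first is nonempty. -/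
lemma bernoulliProb_exists_pair_le (h0 : 0 < p) (h1 : p ≤ 1)
    (hL : 1000 ≤ L) (hn : (Fintype.card α : ℝ) = Real.exp L)
    {Q : Finset α × Finset α → Finset (α × α) → Prop} {s : Finset (Finset α × Finset α)}
    (hs : ∀ k ∈ s, k.1.Nonempty)
    (hQ : ∀ k ∈ s, bernoulliProb p (Q k) ≤ Real.exp (-(4 * (k.1.card + k.2.card) * L))) :
    bernoulliProb p (fun E => ∃ k ∈ s, Q k E) ≤ Real.exp 2 * Real.exp (-L) := by
  refine (bernoulliProb_exists_le h0.le h1 _ _).trans ((Finset.sum_le_sum hQ).trans ?_)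
  have hb : ∀ k ∈ s, Real.exp (-(4 * (k.1.card + k.2.card) * L)) ≤
      Real.exp (-L) * (Real.exp (-L) ^ k.1.card * Real.exp (-L) ^ k.2.card) := by
    intro k hk
    rw [← Real.exp_nat_mul, ← Real.exp_nat_mul, ← Real.exp_add, ← Real.exp_add, Real.exp_le_exp]
    have h2 : (1 : ℝ) ≤ k.1.card := by exact_mod_cast (hs k hk).card_pos
    have h3 : (0 : ℝ) ≤ k.2.card := Nat.cast_nonneg _
    nlinarith
  -- As exp(-L) = 1/n, the sum over all pairs of sets is (1 + 1/n)^(2n) ≤ e². The additional factor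
  -- exp(-L) is available because the first set is nonempty.
  calc ∑ k ∈ s, Real.exp (-(4 * (k.1.card + k.2.card) * L))
      ≤ ∑ k ∈ s, Real.exp (-L) * (Real.exp (-L) ^ k.1.card * Real.exp (-L) ^ k.2.card) :=
        Finset.sum_le_sum hb
    _ ≤ ∑ k : Finset α × Finset α,
        Real.exp (-L) * (Real.exp (-L) ^ k.1.card * Real.exp (-L) ^ k.2.card) :=
        Finset.sum_le_univ_sum_of_nonneg fun k => by positivity
    _ = Real.exp (-L) * ((Real.exp (-L) + 1) ^ Fintype.card α *
        (Real.exp (-L) + 1) ^ Fintype.card α) := by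
        rw [← Finset.mul_sum, Fintype.sum_prod_type, ← Fintype.sum_pow_mul_eq_add_pow]
        simp only [one_pow, mul_one]
        rw [Finset.sum_mul_sum]
    _ ≤ Real.exp (-L) * (Real.exp 1 * Real.exp 1) := by
        have : (Real.exp (-L) + 1) ^ Fintype.card α ≤ Real.exp 1 := by
          calc (Real.exp (-L) + 1) ^ Fintype.card α ≤ Real.exp (Real.exp (-L)) ^ Fintype.card α := by
                gcongr
                exact Real.add_one_le_exp _
            _ = Real.exp 1 := by
                rw [← Real.exp_nat_mul, hn, ← Real.exp_add]; simp
        gcongr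
    _ = _ := by rw [← Real.exp_add]; ring_nf

lemma bernoulliProb_edgeCount_gt_le (h0 : 0 < p) (h1 : p ≤ 1)
    (hL : 1000 ≤ L) (hn : (Fintype.card α : ℝ) = Real.exp L) :
    bernoulliProb p (fun E : Finset (α × α) =>
      ∃ k ∈ (Finset.univ.filter fun k : Finset α × Finset α => k.1.Nonempty),
      ¬ (edgeCount E k.1 k.2 : ℝ) ≤
        2 * p * k.1.card * k.2.card + 4 * (k.1.card + k.2.card) * L) ≤
      Real.exp 2 * Real.exp (-L) := by
  refine bernoulliProb_exists_pair_le h0 h1 hL hn (fun k hk => (Finset.mem_filter.1 hk).2) ?_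
  rintro ⟨S, T⟩ -
  have u := bernoulliProb_chernoff h0.le h1 (c := 1) (by simp) (S ×ˢ T)
    (2 * p * S.card * T.card + 4 * (S.card + T.card) * L)
  refine (bernoulliProb_mono h0.le h1 fun E hE => ?_).trans (u.trans (Real.exp_le_exp.2 ?_))
  · rw [← edgeCount_eq_card_inter, one_mul, one_mul]
    exact (not_le.1 hE).le
  · rw [Finset.card_product]
    push_cast
    exact le_of_eq (by ring)

lemma bernoulliProb_edgeCount_lt_le (h0 : 0 < p) (h1 : p ≤ 1)
    (hL : 1000 ≤ L) (hn : (Fintype.card α : ℝ) = Real.exp L) :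
    bernoulliProb p (fun E : Finset (α × α) =>
      ∃ k ∈ (Finset.univ.filter fun k : Finset α × Finset α =>
        128 * L ≤ p * k.1.card ∧ 128 * L ≤ p * k.2.card),
      ¬ p * k.1.card * k.2.card / 2 ≤ (edgeCount E k.1 k.2 : ℝ)) ≤
      Real.exp 2 * Real.exp (-L) := by
  refine bernoulliProb_exists_pair_le h0 h1 hL hn (fun k hk => ?_) ?_
  · have h2 := (Finset.mem_filter.1 hk).2.1
    rw [← Finset.card_pos]
    by_contra hcon
    have : k.1.card = 0 := by omega
    rw [this] at h2
    norm_num at h2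
    linarith
  rintro ⟨S, T⟩ hST
  obtain ⟨-, hS, hT⟩ := Finset.mem_filter.1 hST
  -- The exponent is -p|S||T|/16. The thresholds 128L give p|S||T| ≥ 64(|S| + |T|)L, which is just
  -- what the union bound needs.
  have u := bernoulliProb_chernoff h0.le h1 (c := -(1 / 4)) (by norm_num) (S ×ˢ T)
    (p * S.card * T.card / 2)
  refine (bernoulliProb_mono h0.le h1 fun E hE => ?_).trans (u.trans (Real.exp_le_exp.2 ?_))
  · rw [← edgeCount_eq_card_inter]
    linarith [not_le.1 hE]
  · rw [Finset.card_product]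
    push_cast
    simp only at hS hT
    have h2 : 128 * L * T.card ≤ p * S.card * T.card := by gcongr
    have h3 : 128 * L * S.card ≤ p * T.card * S.card := by gcongr
    nlinarith

lemma bernoulliProb_card_le (h0 : 0 < p) (h1 : p ≤ 1) (hN : Fintype.card α * p = r ^ 2)
    (hr : 1 ≤ r) (hn : (Fintype.card α : ℝ) = Real.exp L) :
    bernoulliProb p (fun E : Finset (α × α) =>
      ¬ (E.card : ℝ) ≤ Fintype.card α * (r ^ 2 + r / 16)) ≤ Real.exp 66 * Real.exp (-L) := by
  -- This minimizes (cr)² - cr/16; the minimum -1/1024 is then multiplied by n.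
  set c : ℝ := 1 / (32 * r) with hc
  have hc0 : 0 < c := by positivity
  have hc1 : c ≤ 1 := by rw [hc, div_le_one (by positivity)]; linarith
  have hcr : c * r = 1 / 32 := by rw [hc]; field_simp
  have u := bernoulliProb_chernoff h0.le h1 (c := c) (by rw [abs_of_pos hc0]; exact hc1)
    (Finset.univ : Finset (α × α)) (Fintype.card α * (r ^ 2 + r / 16))
  refine (bernoulliProb_mono h0.le h1 fun E hE => ?_).trans (u.trans ?_)
  · rw [Finset.inter_univ]
    exact mul_le_mul_of_nonneg_left (not_le.1 hE).le hc0.le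
  · rw [← Real.exp_add, Real.exp_le_exp, Finset.card_univ, Fintype.card_prod]
    push_cast
    have h3 : p * (Fintype.card α * Fintype.card α) * (c + c ^ 2) -
        c * (Fintype.card α * (r ^ 2 + r / 16)) =
        Fintype.card α * ((c * r) ^ 2 - (c * r) / 16) := by
      rw [show p * ((Fintype.card α : ℝ) * Fintype.card α) =
        Fintype.card α * (Fintype.card α * p) by ring, hN]
      ring
    rw [h3, hcr, hn]
    have h4 : Real.exp L = Real.exp 7 * Real.exp (L - 7) := by rw [← Real.exp_add]; ring_nf
    have h5 : (1024 : ℝ) ≤ Real.exp 7 := by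
      have : Real.exp 7 = Real.exp 1 ^ 7 := by rw [← Real.exp_nat_mul]; norm_num
      rw [this]
      calc (1024 : ℝ) ≤ 2.7 ^ 7 := by norm_num
        _ ≤ _ := by gcongr; linarith [Real.exp_one_gt_d9]
    have h6 := Real.add_one_le_exp (L - 7)
    have h7 : 1024 * Real.exp (L - 7) ≤ Real.exp L := by rw [h4]; gcongr
    nlinarith

/-- If all degrees were below r² + r/8, every exp(c deg(x)) would be at most half its mean μ. The
second moment of the sum over independent rows makes this unlikely, because the ratio of E exp(2c
deg(x)) to μ² is bounded. -/
lemma bernoulliProb_maxDegree_le [Nonempty α] (h0 : 0 < p) (h1 : p ≤ 1 / 2)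
    (hN : Fintype.card α * p = r ^ 2)
    (hr : 1000 ≤ r) (hn : (Fintype.card α : ℝ) = Real.exp L) :
    bernoulliProb p (fun E : Finset (α × α) =>
      ¬ ∃ x, r ^ 2 + r / 8 ≤ rowDeg E x) ≤ Real.exp 66 * Real.exp (-L) := by
  set c : ℝ := 4 / r with hc
  have hr0 : 0 < r := by linarith
  have hc0 : 0 < c := by positivity
  have hc1 : c ≤ 1 / 10 := by rw [hc, div_le_div_iff₀ hr0 (by norm_num)]; linarith
  have hcr : c * r = 4 := by rw [hc]; field_simp
  have u := bernoulliProb_sum_exp_le h0.le (by linarith) (κ := α)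
    (A := fun x => ({x} : Finset α) ×ˢ (Finset.univ : Finset α)) (m := Fintype.card α)
    (by simp) (by
      intro k l hkl
      rw [Finset.disjoint_left]
      rintro e he he'
      simp only [Finset.mem_product, Finset.mem_singleton] at he he'
      exact hkl (he.1.symm.trans he'.1)) c
  set n := Fintype.card α with hn'
  set μ : ℝ := (1 + p * (Real.exp c - 1)) ^ n with hμ
  have hμlow : Real.exp (c * r ^ 2 + 2) ≤ μ := by
    have h2 : c + c ^ 2 / 2 ≤ Real.exp c - 1 := by
      linarith [Real.quadratic_le_exp_of_nonneg hc0.le]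
    have h3 : Real.exp (p * (c + c ^ 2 / 2) - (p * (c + c ^ 2 / 2)) ^ 2 / 2) ≤
        1 + p * (Real.exp c - 1) := by
      have hu0 : 0 < p * (c + c ^ 2 / 2) := by positivity
      set u := p * (c + c ^ 2 / 2) with hu
      have h4 : 1 + u ≤ 1 + p * (Real.exp c - 1) := by
        have : u ≤ p * (Real.exp c - 1) := mul_le_mul_of_nonneg_left h2 h0.le
        linarith
      refine le_trans ?_ h4
      rw [← Real.le_log_iff_exp_le (by linarith)]
      refine le_trans ?_ (Real.le_log_one_add_of_nonneg hu0.le)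
      rw [le_div_iff₀ (by linarith)]
      nlinarith [pow_pos hu0 3]
    calc Real.exp (c * r ^ 2 + 2)
        ≤ Real.exp (n * (p * (c + c ^ 2 / 2) - (p * (c + c ^ 2 / 2)) ^ 2 / 2)) := by
          rw [Real.exp_le_exp]
          -- The bound p ≤ 1/2 keeps the variance of a degree comparable to np; without it the
          -- quadratic gain in the exponent of μ could vanish.
          have h5 : p ^ 2 * (1 + c / 2) ^ 2 ≤ p * (1 / 2 * 1.1025) := by
            have : (1 + c / 2) ^ 2 ≤ 1.1025 := by nlinarith
            calc p ^ 2 * (1 + c / 2) ^ 2 ≤ p ^ 2 * 1.1025 := by gcongr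
              _ ≤ _ := by nlinarith
          have h6 : (n : ℝ) * (p * (c + c ^ 2 / 2) - (p * (c + c ^ 2 / 2)) ^ 2 / 2) =
              n * p * c + n * p * c ^ 2 / 2 - n * c ^ 2 / 2 * (p ^ 2 * (1 + c / 2) ^ 2) := by ring
          have h7 : n * c ^ 2 / 2 * (p ^ 2 * (1 + c / 2) ^ 2) ≤
              n * c ^ 2 / 2 * (p * (1 / 2 * 1.1025)) := by gcongr
          have h8 : n * c ^ 2 / 2 * (p * (1 / 2 * 1.1025)) =
            (n * p) * c ^ 2 * 0.275625 := by ring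
          rw [h8] at h7
          rw [h6]
          rw [hN] at h7 ⊢
          have h9 : r ^ 2 * c ^ 2 = 16 := by rw [← mul_pow, mul_comm r c, hcr]; norm_num
          linarith
      _ = Real.exp (p * (c + c ^ 2 / 2) - (p * (c + c ^ 2 / 2)) ^ 2 / 2) ^ n := by
          rw [← Real.exp_nat_mul]
      _ ≤ μ := by rw [hμ]; gcongr
  have hnu : (1 + p * (Real.exp (2 * c) - 1)) ^ n ≤ Real.exp (2 * (c * r ^ 2) + 64) := by
    refine (one_add_mul_exp_sub_one_pow_le h0.le (by linarith)
      (by rw [abs_of_pos (by linarith)]; linarith) n).trans (Real.exp_le_exp.2 (le_of_eq ?_))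
    rw [mul_comm p, hN]
    have h9 : r ^ 2 * c ^ 2 = 16 := by rw [← mul_pow, mul_comm r c, hcr]; norm_num
    linear_combination 4 * h9
  refine (bernoulliProb_mono h0.le (by linarith) fun E hE => ?_).trans (u.trans ?_)
  · push Not at hE
    have h2 : ∀ x ∈ (Finset.univ : Finset α),
        Real.exp (c * (E ∩ ({x} : Finset α) ×ˢ (Finset.univ : Finset α)).card) ≤ μ / 2 := by
      intro x _
      rw [← rowDeg_eq_card_inter]
      have h3 : c * rowDeg E x ≤ c * r ^ 2 + 1 / 2 := by
        have : c * rowDeg E x ≤ c * (r ^ 2 + r / 8) := by gcongr; exact (hE x).le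
        have h4 : c * (r ^ 2 + r / 8) = c * r ^ 2 + (c * r) / 8 := by ring
        rw [h4, hcr] at this
        linarith
      have h4 : 2 * Real.exp (c * r ^ 2 + 1 / 2) ≤ Real.exp (c * r ^ 2 + 2) := by
        rw [show c * r ^ 2 + 2 = 3 / 2 + (c * r ^ 2 + 1 / 2) by ring, Real.exp_add (3 / 2)]
        gcongr
        linarith [Real.add_one_le_exp (3 / 2 : ℝ)]
      have := Real.exp_le_exp.2 h3
      linarith
    calc _ ≤ ∑ x : α, μ / 2 := Finset.sum_le_sum h2
      _ = _ := by rw [Finset.sum_const, Finset.card_univ, nsmul_eq_mul]; ring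
  · have hμ2 : Real.exp (2 * (c * r ^ 2) + 4) ≤ μ ^ 2 := by
      calc Real.exp (2 * (c * r ^ 2) + 4) = Real.exp (c * r ^ 2 + 2) ^ 2 := by
            rw [← Real.exp_nat_mul]; push_cast; ring_nf
        _ ≤ _ := by gcongr
    rw [hn]
    -- The constant 66 is 6 + 64 - 4: from this bound, from the numerator and from μ².
    have h5 : (4 : ℝ) ≤ Real.exp 6 := by linarith [Real.add_one_le_exp (6 : ℝ)]
    have hnn : 0 ≤ (1 + p * (Real.exp (2 * c) - 1)) ^ n := by
      have : 0 ≤ Real.exp (2 * c) - 1 := by linarith [Real.add_one_le_exp (2 * c)]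
      positivity
    calc 4 * (1 + p * (Real.exp (2 * c) - 1)) ^ n / (Real.exp L * μ ^ 2)
        ≤ Real.exp 6 * Real.exp (2 * (c * r ^ 2) + 64) /
          (Real.exp L * Real.exp (2 * (c * r ^ 2) + 4)) := by gcongr
      _ = _ := by
        rw [← Real.exp_add, ← Real.exp_add, ← Real.exp_sub, ← Real.exp_add]
        ring_nf

lemma sum_colDeg_eq (E : Finset (α × α)) (x : α) {W : Finset α}
    (hW : E ∩ {x} ×ˢ Finset.univ = {x} ×ˢ W) :
    ∑ e ∈ E.filter (fun e => e.1 = x), colDeg E e.2 = W.card + (E ∩ {x}ᶜ ×ˢ W).card := by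
  have h1 : E.filter (fun e => e.1 = x) = {x} ×ˢ W := by
    rw [← hW]
    ext e
    simp only [Finset.mem_filter, Finset.mem_inter, Finset.mem_product, Finset.mem_singleton,
      Finset.mem_univ, and_true]
  rw [h1, Finset.sum_product, Finset.sum_singleton, sum_colDeg]
  have h2 : E.filter (fun e => e.2 ∈ W) = ({x} ×ˢ W) ∪ (E ∩ {x}ᶜ ×ˢ W) := by
    ext ⟨a, b⟩
    have := Finset.ext_iff.1 hW (a, b)
    simp only [Finset.mem_inter, Finset.mem_product, Finset.mem_singleton, Finset.mem_univ,
      and_true, Finset.mem_filter, Finset.mem_union, Finset.mem_compl] at this ⊢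
    tauto
  rw [h2, Finset.card_union_of_disjoint, Finset.card_product, Finset.card_singleton, one_mul]
  rw [Finset.disjoint_left]
  rintro ⟨a, b⟩
  simp only [Finset.mem_inter, Finset.mem_product, Finset.mem_singleton, Finset.mem_compl]
  tauto

/-- Given that W is the neighbourhood of x, the degrees in W sum to |W|, for the edges at x, plus
the number of edges from the other rows to W. These are independent of the row of x, so Chernoff's
inequality applies conditionally. The term 1 in the bound accounts for the edges at x. -/
lemma bernoulliProb_sum_colDeg_le (h0 : 0 < p) (h1 : p ≤ 1) (hN : Fintype.card α * p = r ^ 2)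
    (hL : 1000 ≤ L) (hr : 1000000 * L ^ 3 ≤ r) (hn : (Fintype.card α : ℝ) = Real.exp L) :
    bernoulliProb p (fun E : Finset (α × α) => ∃ x ∈ Finset.univ, r ^ 2 / 2 ≤ rowDeg E x ∧
      ¬ (∑ e ∈ E.filter (fun e => e.1 = x), colDeg E e.2 : ℝ) ≤
        rowDeg E x * (r ^ 2 + 1 + r / 16)) ≤ Real.exp (-L) := by
  have hL2 : 1000000 ≤ L ^ 2 := by nlinarith
  have hLr : 1000000000000 * L ≤ r := by nlinarith
  have hr0 : 0 < r := by linarith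
  refine (bernoulliProb_exists_le h0.le h1 _ _).trans ?_
  set c : ℝ := 1 / (32 * r) with hc
  have hc0 : 0 < c := by positivity
  have hc1 : c ≤ 1 := by rw [hc, div_le_one (by positivity)]; linarith
  have hcr : c * r = 1 / 32 := by rw [hc]; field_simp
  have key : ∀ x ∈ (Finset.univ : Finset α), bernoulliProb p (fun E : Finset (α × α) =>
      r ^ 2 / 2 ≤ rowDeg E x ∧ ¬ (∑ e ∈ E.filter (fun e => e.1 = x), colDeg E e.2 : ℝ) ≤
        rowDeg E x * (r ^ 2 + 1 + r / 16)) ≤ Real.exp (-(2 * L)) := by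
    intro x _
    let s : Finset (Finset α) := Finset.univ.filter fun W => r ^ 2 / 2 ≤ (W.card : ℝ)
    calc _ ≤ bernoulliProb p (fun E : Finset (α × α) => ∃ W ∈ s,
          E ∩ {x} ×ˢ Finset.univ = {x} ×ˢ W ∧
          c * (W.card * (r ^ 2 + r / 16)) ≤ c * (E ∩ {x}ᶜ ×ˢ W).card) := by
          refine bernoulliProb_mono h0.le h1 fun E hE => ?_
          let W : Finset α := Finset.univ.filter fun y => (x, y) ∈ E
          have hW : E ∩ {x} ×ˢ Finset.univ = {x} ×ˢ W := by
            ext ⟨a, b⟩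
            simp only [Finset.mem_inter, Finset.mem_product, Finset.mem_singleton,
              Finset.mem_univ, and_true, W, Finset.mem_filter, true_and]
            constructor
            · rintro ⟨h, rfl⟩; exact ⟨rfl, h⟩
            · rintro ⟨rfl, h⟩; exact ⟨h, rfl⟩
          have hWc : rowDeg E x = W.card := by
            rw [rowDeg_eq_card_inter, hW]; simp
          refine ⟨W, Finset.mem_filter.2 ⟨Finset.mem_univ _, hWc ▸ hE.1⟩, hW, ?_⟩
          have h3 := not_le.1 hE.2
          have h4 : (∑ e ∈ E.filter (fun e => e.1 = x), colDeg E e.2 : ℝ) =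
              W.card + (E ∩ {x}ᶜ ×ˢ W).card := by exact_mod_cast sum_colDeg_eq E x hW
          rw [h4, hWc] at h3
          exact mul_le_mul_of_nonneg_left (by linarith) hc0.le
      _ ≤ ∑ W ∈ s, bernoulliProb p (fun E : Finset (α × α) =>
          E ∩ {x} ×ˢ Finset.univ = {x} ×ˢ W ∧
          c * (W.card * (r ^ 2 + r / 16)) ≤ c * (E ∩ {x}ᶜ ×ˢ W).card) :=
          bernoulliProb_exists_le h0.le h1 _ _
      _ ≤ ∑ W ∈ s, bernoulliProb p (fun E : Finset (α × α) =>
          E ∩ {x} ×ˢ Finset.univ = {x} ×ˢ W) * Real.exp (-(2 * L)) := by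
          refine Finset.sum_le_sum fun W hW => ?_
          refine (bernoulliProb_inter_eq_and_le h0.le h1 (by rw [abs_of_pos hc0]; exact hc1)
            (Finset.product_subset_product_right (Finset.subset_univ W)) ?_ _).trans ?_
          · rw [Finset.disjoint_left]
            rintro ⟨a, b⟩
            simp only [Finset.mem_product, Finset.mem_singleton, Finset.mem_compl]
            tauto
          refine mul_le_mul_of_nonneg_left (Real.exp_le_exp.2 ?_) (bernoulliProb_nonneg h0.le h1 _)
          have hWc : r ^ 2 / 2 ≤ (W.card : ℝ) := (Finset.mem_filter.1 hW).2
          have h3 : p * (({x}ᶜ : Finset α) ×ˢ W).card ≤ r ^ 2 * W.card := by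
            rw [Finset.card_product, ← hN]
            push_cast
            have : (({x}ᶜ : Finset α).card : ℝ) ≤ Fintype.card α := by
              exact_mod_cast Finset.card_le_univ _
            calc p * (({x}ᶜ : Finset α).card * (W.card : ℝ)) ≤ p * (Fintype.card α * W.card) := by
                  gcongr
              _ = _ := by ring
          have h4 : p * (({x}ᶜ : Finset α) ×ˢ W).card * (c + c ^ 2) ≤
              r ^ 2 * W.card * (c + c ^ 2) := by gcongr
          have h5 : r ^ 2 * W.card * (c + c ^ 2) - c * (W.card * (r ^ 2 + r / 16)) =
              W.card * ((c * r) ^ 2 - (c * r) / 16) := by ring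
          rw [hcr] at h5
          nlinarith
      _ ≤ 1 * Real.exp (-(2 * L)) := by
          rw [← Finset.sum_mul]
          gcongr
          have := sum_bernoulliProb_inter_eq_le h0.le h1 (({x} : Finset α) ×ˢ Finset.univ)
            (s.image fun W => {x} ×ˢ W)
          rwa [Finset.sum_image] at this
          intro W _ W' _ h
          ext y
          have := Finset.ext_iff.1 h (x, y)
          simpa using this
      _ = _ := one_mul _
  refine (Finset.sum_le_sum key).trans_eq ?_
  rw [Finset.sum_const, Finset.card_univ, nsmul_eq_mul, hn, ← Real.exp_add]
  ring_nf

lemma bernoulliProb_not_isRowPseudorandom_le [Nonempty α] (h0 : 0 < p) (h1 : p ≤ 1 / 2)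
    (hN : Fintype.card α * p = r ^ 2) (hL : 1000 ≤ L) (hr : 1000000 * L ^ 3 ≤ r)
    (hn : (Fintype.card α : ℝ) = Real.exp L) :
    bernoulliProb p (fun E : Finset (α × α) => ¬ IsRowPseudorandom E p L r) ≤
      6 * Real.exp 66 * Real.exp (-L) := by
  have hL2 : 1000000 ≤ L ^ 2 := by nlinarith
  have hLr : 1000000000000 * L ≤ r := by nlinarith
  have hr0 : 0 < r := by linarith
  have h1' : p ≤ 1 := by linarith
  have b1 := bernoulliProb_rowDeg_le h0 h1' hN hL hr hn
  have b2 := bernoulliProb_edgeCount_gt_le (α := α) h0 h1' hL hn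
  have b3 := bernoulliProb_edgeCount_lt_le (α := α) h0 h1' hL hn
  have b4 := bernoulliProb_card_le h0 h1' hN (by linarith) hn
  have b5 := bernoulliProb_maxDegree_le h0 h1 hN (by linarith) hn
  have b6 := bernoulliProb_sum_colDeg_le h0 h1' hN hL hr hn
  have e1 : Real.exp 2 ≤ Real.exp 66 := Real.exp_le_exp.2 (by norm_num)
  have e2 : (2 : ℝ) ≤ Real.exp 66 := by linarith [Real.add_one_le_exp (66 : ℝ)]
  have e3 : Real.exp 2 * Real.exp (-L) ≤ Real.exp 66 * Real.exp (-L) := by gcongr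
  have e4 : 2 * Real.exp (-L) ≤ Real.exp 66 * Real.exp (-L) := by gcongr
  have e5 := Real.exp_pos (-L)
  refine (bernoulliProb_mono h0.le h1' (R := fun E => _ ∨ (_ ∨ (_ ∨ (_ ∨ (_ ∨ _)))))
    fun E hE => ?_).trans
    ((bernoulliProb_or_le h0.le h1' b1 (bernoulliProb_or_le h0.le h1' b2
      (bernoulliProb_or_le h0.le h1' b3 (bernoulliProb_or_le h0.le h1' b4
        (bernoulliProb_or_le h0.le h1' b5 b6))))).trans ?_)
  · by_contra! hcon
    obtain ⟨c1, c2, c3, c4, c5, c6⟩ := hcon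
    have d1 : ∀ x, |(rowDeg E x : ℝ) - r ^ 2| ≤ r * L := fun x => c1 x (Finset.mem_univ x)
    refine hE ⟨d1, fun S T => ?_, fun S T hS hT => ?_, c4, c5, fun x => ?_⟩
    · rcases S.eq_empty_or_nonempty with rfl | hS
      · simp only [edgeCount, Finset.notMem_empty, false_and, Finset.filter_false,
          Finset.card_empty, Nat.cast_zero, mul_zero, zero_mul, zero_add]
        positivity
      · exact c2 (S, T) (Finset.mem_filter.2 ⟨Finset.mem_univ _, hS⟩)
    · exact c3 (S, T) (Finset.mem_filter.2 ⟨Finset.mem_univ _, hS, hT⟩)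
    · have h6 := (abs_le.1 (d1 x)).1
      exact c6 x (Finset.mem_univ x) (by nlinarith)
  · linarith

/-- The random bipartite graph is pseudorandom with high probability. -/
theorem bernoulliProb_not_isPseudorandom_le [Nonempty α] (h0 : 0 < p) (h1 : p ≤ 1 / 2)
    (hN : Fintype.card α * p = r ^ 2) (hL : 1000 ≤ L) (hr : 1000000 * L ^ 3 ≤ r)
    (hn : (Fintype.card α : ℝ) = Real.exp L) :
    bernoulliProb p (fun E : Finset (α × α) => ¬ IsPseudorandom E p L r) ≤
      12 * Real.exp 66 * Real.exp (-L) := by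
  have b1 := bernoulliProb_not_isRowPseudorandom_le h0 h1 hN hL hr hn
  have b2 := b1
  rw [← bernoulliProb_swapEdges] at b2
  refine (bernoulliProb_mono h0.le (by linarith) (R := fun E => _ ∨ _) fun E hE => ?_).trans
    ((bernoulliProb_or_le h0.le (by linarith) b1 b2).trans_eq (by ring))
  exact not_and_or.1 hE

end RandomBipartite

/-! ### Transfer to the law of the random graph and conclusion. -/

section Law

lemma setBernoulli_real_coe {ι : Type*} [Fintype ι] [DecidableEq ι] (p : I) (E : Finset ι) :
    (setBernoulli (Set.univ : Set ι) p).real {(E : Set ι)} = bernoulliWeight (p : ℝ) E := by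
  rw [setBernoulli_real_singleton p (Set.subset_univ _) Set.finite_univ, bernoulliWeight,
    Finset.prod_ite, Finset.prod_const, Finset.prod_const, Set.ncard_coe_finset]
  congr 2
  · congr 1; ext; simp
  · rw [← Set.ncard_coe_finset]
    congr 1; ext; simp

open scoped Classical in
lemma setBernoulli_real_setOf {ι : Type*} [Fintype ι] [DecidableEq ι] (p : I)
    (Q : Finset ι → Prop) :
    (setBernoulli (Set.univ : Set ι) p).real {s | Q s.toFinset} = bernoulliProb (p : ℝ) Q := by
  have h : {s : Set ι | Q s.toFinset} =
      (((Finset.univ.filter Q).image fun E : Finset ι => (E : Set ι) : Finset (Set ι)) :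
        Set (Set ι)) := by
    ext s
    simp only [Set.mem_ofPred_eq, Finset.coe_image, Finset.coe_filter, Finset.mem_univ, true_and,
      Set.mem_image]
    constructor
    · intro h; exact ⟨s.toFinset, h, by simp⟩
    · rintro ⟨E, hE, rfl⟩; simpa using hE
  rw [h, ← sum_measureReal_singleton, Finset.sum_image (fun _ _ _ _ h => Finset.coe_injective h),
    Finset.sum_filter]
  refine Finset.sum_congr rfl fun E _ => ?_
  rw [setBernoulli_real_coe]
  split_ifs <;> simp

/-- Properties implied by pseudorandomness are likely for the random bipartite graph. -/
lemma le_binomialRandomBipartite {n : ℕ} (p : I) {S : Set (SimpleGraph (Fin n ⊕ Fin n))}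
    {Q : Finset (Fin n × Fin n) → Prop} {ε : ℝ}
    (hQ : ∀ E : Finset (Fin n × Fin n), Q E → bipartiteGraph n (E : Set (Fin n × Fin n)) ∈ S)
    (hε : bernoulliProb (p : ℝ) (fun E => ¬ Q E) ≤ ε) :
    1 - ENNReal.ofReal ε ≤ binomialRandomBipartite n p S := by
  classical
  set μ := setBernoulli (Set.univ : Set (Fin n × Fin n)) p
  have h1 : μ {s | ¬ Q s.toFinset} ≤ ENNReal.ofReal ε := by
    rw [← setBernoulli_real_setOf] at hε
    rw [← ofReal_measureReal]
    exact ENNReal.ofReal_le_ofReal hε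
  have h2 : μ {s | Q s.toFinset} ≤ binomialRandomBipartite n p S := by
    refine le_trans (measure_mono ?_)
      (Measure.le_map_apply (measurable_of_countable _).aemeasurable S)
    intro s hs
    have := hQ _ hs
    rwa [Set.coe_toFinset] at this
  rw [tsub_le_iff_right]
  calc (1 : ENNReal) = μ Set.univ := measure_univ.symm
    _ ≤ μ ({s | Q s.toFinset} ∪ {s | ¬ Q s.toFinset}) := by
      refine measure_mono fun s _ => ?_
      exact em _
    _ ≤ _ := (measure_union_le _ _).trans (add_le_add h2 h1)

end Law

theorem lemma3p1 (p : ℕ → I)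
    (hp : ∀ᶠ n : ℕ in atTop, Real.log n ^ 10 / n ≤ (p n : ℝ) ∧ (p n : ℝ) ≤ 1 / 2) :
    Tendsto
      (fun n : ℕ => binomialRandomBipartite n (p n)
        {B | ∀ B' : SimpleGraph (Fin n ⊕ Fin n),
          IsMaxDegreeDeletion B B' → HasOptimalMatchingCover B'})
      atTop (𝓝 1) := by
  have hlog : Tendsto (fun n : ℕ => Real.log n) atTop atTop :=
    Real.tendsto_log_atTop.comp tendsto_natCast_atTop_atTop
  have hlim : Tendsto (fun n : ℕ => 1 - ENNReal.ofReal (12 * Real.exp 66 * Real.exp (-Real.log n)))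
      atTop (𝓝 1) := by
    have h1 : Tendsto (fun n : ℕ => 12 * Real.exp 66 * Real.exp (-Real.log n)) atTop (𝓝 0) := by
      simpa using (Real.tendsto_exp_neg_atTop_nhds_zero.comp hlog).const_mul (12 * Real.exp 66)
    have h2 := ENNReal.Tendsto.sub (tendsto_const_nhds (x := (1 : ENNReal)))
      (ENNReal.tendsto_ofReal h1) (Or.inl ENNReal.one_ne_top)
    simpa using h2
  refine tendsto_of_tendsto_of_tendsto_of_le_of_le' hlim tendsto_const_nhds ?_
    (Eventually.of_forall fun n => prob_le_one)
  filter_upwards [hp, hlog.eventually_ge_atTop 1000, eventually_gt_atTop 0] with n hpn hL hn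
  have : NeZero n := ⟨hn.ne'⟩
  have hn' : (0 : ℝ) < n := by exact_mod_cast hn
  set L := Real.log n
  have hL0 : 0 < L := by linarith
  have hp0 : 0 < (p n : ℝ) := lt_of_lt_of_le (by positivity) hpn.1
  have hnp : L ^ 10 ≤ n * (p n : ℝ) := by
    have := (div_le_iff₀ hn').1 hpn.1
    linarith
  have hsq : n * (p n : ℝ) = Real.sqrt (n * (p n : ℝ)) ^ 2 := (Real.sq_sqrt (by positivity)).symm
  -- The tenth power of the logarithm gives r ≥ L⁵, and two of these factors absorb the constant
  -- since L ≥ 1000.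
  have hr : 1000000 * L ^ 3 ≤ Real.sqrt (n * (p n : ℝ)) := by
    calc 1000000 * L ^ 3 ≤ L ^ 2 * L ^ 3 := by
          gcongr
          nlinarith
      _ = L ^ 5 := by ring
      _ ≤ _ := Real.le_sqrt_of_sq_le (le_of_eq_of_le (by ring) hnp)
  refine le_binomialRandomBipartite (p n)
    (Q := fun E => IsPseudorandom E (p n : ℝ) L (Real.sqrt (n * (p n : ℝ)))) ?_ ?_
  · intro E hE B' hB'
    exact hE.hasOptimalMatchingCover hp0 hsq hL hr hB'
  · exact bernoulliProb_not_isPseudorandom_le hp0 hpn.2 (by simpa using hsq) hL hr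
      (by rw [Fintype.card_fin]; exact (Real.exp_log hn').symm)
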